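/- There is an absolute constant $K>0$ such that the following holds. Let $\Gamma$ be a hyperbolic surface group, that is, the fundamental group of a closed surface of constant curvature $-1$ (equivalently, a group acting freely, properly discontinuously and cocompactly by isometries on $\mathbb{H}^2$). Let $\rho,\rho_\ast:\Gamma\to \mathrm{PSL}_2(\mathbb{C})$ be convex-cocompact representations: the induced actions on $\mathbb{H}^3$ are properly discontinuous, and cocompact on the (nonempty) convex hull of the limit set. For $g\in\Gamma$ with conjugacy class $[g]$ let $\ell_\rho[g]=\lim_{k\to\infty}\frac1k d_{\mathbb{H}^3}(x,\rho(g)^k x)$, which is independent of $x\in\mathbb{H}^3$, be the stable translation length, and define $\ell_{\rho_\ast}$ in the same way. Let $D\ge 0$ and suppose that the $\rho$-action on the convex hull $C_\rho\subset\mathbb{H}^3$ of the limit set $\Lambda_{\rho(\Gamma)}$ is $D$-cobounded: for all $x,x'\in C_\rho$ there is $g\in\Gamma$ with $d_{\mathbb{H}^3}(\rho(g)x,x')\le D$. Let $L>6D$. Then $\ell_\rho[g]>0$ for every non-torsion class $[g]$, the maximum and the supremum below exist as real numbers, and $$\sup_{[g]\ \text{non-torsion}}\frac{\ell_{\rho_\ast}[g]}{\ell_\rho[g]}\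 \le\ \frac{L}{L-6D}\cdot\left(\max_{0<\ell_\rho[g]\le L}\frac{\ell_{\rho_\ast}[g]}{\ell_\rho[g]}\right)+\frac{2K\log 4}{L-6D}.$$ -/

import Mathlib

open scoped MatrixGroups Matrix ComplexOrder

/-- A group is a hyperbolic surface group if it is the fundamental group of a closed surface
`ℍ² / Γ` of constant curvature `-1`, that is, if it acts on the hyperbolic plane by isometries,
freely, properly discontinuously and cocompactly. -/
def IsHyperbolicSurfaceGroup (Γ : Type*) [Group Γ] : Prop :=
  ∃ φ : Γ →* (UpperHalfPlane ≃ᵢ UpperHalfPlane),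
    (∀ g : Γ, g ≠ 1 → ∀ z, φ g z ≠ z) ∧
    (∀ C : Set UpperHalfPlane, IsCompact C → {g : Γ | (φ g '' C ∩ C).Nonempty}.Finite) ∧
    ∃ C : Set UpperHalfPlane, IsCompact C ∧ ∀ z, ∃ g : Γ, φ g z ∈ C

/-- Hyperbolic 3-space, in the hyperboloid model: the Hermitian `2 × 2` matrices with the
quadratic form `det` are Minkowski 4-space, and `ℍ³` is the sheet of positive definite matrices
of determinant one. It carries the subspace topology. -/
abbrev Hyp3 : Type :=
  {X : Matrix (Fin 2) (Fin 2) ℂ // X.PosDef ∧ X.det = 1}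

namespace Hyp3

/-- The base point of `ℍ³`. -/
def origin : Hyp3 := ⟨1, Matrix.PosDef.one, Matrix.det_one⟩

/-- The hyperbolic distance (curvature `-1`): `cosh d(X, Y) = tr(X⁻¹ Y) / 2`, the Minkowski
product of `X` and `Y`. -/
noncomputable def hdist (X Y : Hyp3) : ℝ :=
  Real.arcosh ((X.1⁻¹ * Y.1).trace.re / 2)

/-- The isometric action of `SL₂(ℂ)` on `ℍ³`: `A • X = A X Aᴴ`. -/
instance instMulActionSL : MulAction SL(2, ℂ) Hyp3 where
  smul A X := ⟨A.1 * X.1 * A.1ᴴ, by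
    refine X.2.1.mul_mul_conjTranspose_same ?_
    rw [Matrix.vecMul_injective_iff_isUnit, Matrix.isUnit_iff_isUnit_det, A.2]
    exact isUnit_one, by
    rw [Matrix.det_mul, Matrix.det_mul, Matrix.det_conjTranspose, A.2, X.2.2]; simp⟩
  one_smul X := Subtype.ext (by
    change (1 : Matrix (Fin 2) (Fin 2) ℂ) * X.1 * (1 : Matrix (Fin 2) (Fin 2) ℂ)ᴴ = X.1
    simp)
  mul_smul A B X := Subtype.ext (by
    change (A.1 * B.1) * X.1 * (A.1 * B.1)ᴴ = A.1 * (B.1 * X.1 * B.1ᴴ) * A.1ᴴ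
    simp only [Matrix.conjTranspose_mul, Matrix.mul_assoc])

theorem coe_smul (A : SL(2, ℂ)) (X : Hyp3) : (A • X).1 = A.1 * X.1 * A.1ᴴ := rfl

theorem center_smul (A : SL(2, ℂ)) (hA : A ∈ Subgroup.center SL(2, ℂ)) (X : Hyp3) :
    A • X = X := by
  obtain ⟨r, hr, hA⟩ := Matrix.SpecialLinearGroup.mem_center_iff.1 hA
  rw [Fintype.card_fin] at hr
  apply Subtype.ext
  rw [coe_smul, ← hA]
  have h1 : r * star r = 1 := by
    rcases sq_eq_one_iff.1 hr with h | h <;> simp [h]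
  ext i j
  simp only [Matrix.scalar_apply, Matrix.diagonal_conjTranspose, Matrix.mul_diagonal,
    Matrix.diagonal_mul, Pi.star_apply]
  rw [mul_right_comm, h1, one_mul]

/-- The action of `PSL₂(ℂ) = SL₂(ℂ) / center` on `ℍ³`. -/
def pslHom : PSL(2, ℂ) →* Equiv.Perm Hyp3 :=
  QuotientGroup.lift (Subgroup.center SL(2, ℂ)) (MulAction.toPermHom SL(2, ℂ) Hyp3)
    fun A hA => Equiv.ext fun X => center_smul A hA X

/-- The projective (Klein) model: `ℍ³` is identified with the interior of the round ball of
positive semidefinite Hermitian matrices of trace one. -/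
noncomputable def klein (X : Hyp3) : Matrix (Fin 2) (Fin 2) ℂ := X.1.trace⁻¹ • X.1

/-- The ideal boundary of `ℍ³`, as the boundary sphere of the Klein ball: the rank one
orthogonal projections, i.e. the complex lines in `ℂ²`. -/
def idealBoundary : Set (Matrix (Fin 2) (Fin 2) ℂ) :=
  {P | P.PosSemidef ∧ P.trace = 1 ∧ P.det = 0}

end Hyp3

namespace PSLRep

variable {Γ : Type*} [Group Γ]

/-- The action of `Γ` on `ℍ³` induced by a representation `ρ : Γ → PSL₂(ℂ)`. -/
def act (ρ : Γ →* PSL(2, ℂ)) (g : Γ) (X : Hyp3) : Hyp3 := Hyp3.pslHom (ρ g) X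

/-- The limit set of `ρ(Γ)`: the ideal boundary points that are accumulation points of an orbit. -/
def limitSet (ρ : Γ →* PSL(2, ℂ)) : Set (Matrix (Fin 2) (Fin 2) ℂ) :=
  Hyp3.idealBoundary ∩ closure (Set.range fun g : Γ => (act ρ g Hyp3.origin).klein)

/-- The convex hull in `ℍ³` of the limit set. Geodesics are straight segments in the Klein model,
so this is the part inside `ℍ³` of the affine convex hull. -/
def hull (ρ : Γ →* PSL(2, ℂ)) : Set Hyp3 :=
  {X | X.klein ∈ convexHull ℝ (limitSet ρ)}

/-- A representation (of an infinite group) is convex-cocompact if the induced action on `ℍ³` is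
properly discontinuous (equivalently, the kernel is finite and the image discrete), and the action
on the convex hull of the limit set, which is nonempty, is cocompact. -/
def ConvexCocompact (ρ : Γ →* PSL(2, ℂ)) : Prop :=
  (∀ C : Set Hyp3, IsCompact C → {g : Γ | (act ρ g '' C ∩ C).Nonempty}.Finite) ∧
  (hull ρ).Nonempty ∧
  ∃ C : Set Hyp3, IsCompact C ∧ C ⊆ hull ρ ∧ ∀ X ∈ hull ρ, ∃ g : Γ, act ρ g X ∈ C

/-- The action of `Γ` on the convex hull of the limit set is `D`-cobounded. -/
def HullCobounded (ρ : Γ →* PSL(2, ℂ)) (D : ℝ) : Prop :=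
  ∀ X ∈ hull ρ, ∀ Y ∈ hull ρ, ∃ g : Γ, Hyp3.hdist (act ρ g X) Y ≤ D

/-- The stable translation length `ℓ_ρ[g] = lim d(x, gᵏ x) / k` of the action on `ℍ³`. -/
noncomputable def length (ρ : Γ →* PSL(2, ℂ)) (g : Γ) : ℝ :=
  Filter.limUnder Filter.atTop fun k : ℕ => Hyp3.hdist Hyp3.origin (act ρ (g ^ k) Hyp3.origin) / k

end PSLRep

/-! The theorem follows from a local-to-global argument along axes, fed by a joint displacement
bound in `SL(2, ℂ)`.

Joint bound (`exists_conj_nsq_le`, `exists_hdist_act_le`): if all products of two members of a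
finite set have translation length at most `m`, then one point is moved by every member by at most
`m / 2 + log 132`. Translation lengths control traces (`norm_trace_le`), and traces of elements and
of pairwise products control the trace form on the traceless parts, viewed as vectors in `ℂ³`. Among
these vectors a triple of maximal determinant expresses the others with coefficients of modulus at
most one. Conjugate so that this triple has least norm. At the minimum the moment map vanishes, and
then the Gram matrix of the complex bilinear form bounds the Hermitian norms
(`sum_nsq_le_of_moment_eq_zero`).

Local to global (`ConvexCocompact.length_le_of_short_ratio_le`): let `x` lie on the axis of `g` and
let `S` be the finite set of elements that move `x` by at most `L / 2` under `ρ`. A product of two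
members of `S` has `ρ`-length at most `L`, hence `ρs`-length at most `M * L`, so some `y` is moved
by each of them by at most `E = M * L / 2 + log 132` under `ρs`. Cut the segment from `x` to `g ^ m
x` into pieces of length at most `(L - 4 * D) / 2` and approximate the division points by orbit
points of `x`. Consecutive ones differ by members of `S`, so `g ^ m` is a product of about `2 * m *
ℓ / (L - 4 * D)` members of `S`, where `ℓ` is the `ρ`-length of `g`. Dividing by `m` gives the
estimate with `4 * D`, which is stronger than that with `6 * D`.

This needs an axis inside the hull for every non-torsion element (`ConvexCocompact.exists_axis`):
elliptics are excluded by proper discontinuity, and parabolics because they have arbitrarily small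
displacement in the hull. The maximum exists because conjugation brings every short axis near a
fixed point (`ConvexCocompact.finite_ratios`) and because short non-torsion elements exist
(`ConvexCocompact.exists_length_le`). -/

open Filter Topology

/-! ### The metric of hyperbolic space in the Hermitian model -/

/-- The squared Frobenius norm of a complex `2 × 2` matrix. -/
def nsq (M : Matrix (Fin 2) (Fin 2) ℂ) : ℝ :=
  Complex.normSq (M 0 0) + Complex.normSq (M 0 1) + Complex.normSq (M 1 0) + Complex.normSq (M 1 1)

theorem nsq_nonneg (M : Matrix (Fin 2) (Fin 2) ℂ) : 0 ≤ nsq M := by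
  unfold nsq
  have := Complex.normSq_nonneg
  linarith [this (M 0 0), this (M 0 1), this (M 1 0), this (M 1 1)]

theorem trace_mul_conjTranspose_re (M : Matrix (Fin 2) (Fin 2) ℂ) : (M * Mᴴ).trace.re = nsq M := by
  simp only [nsq, Matrix.trace_fin_two, Matrix.mul_apply, Fin.sum_univ_two,
    Matrix.conjTranspose_apply, Complex.normSq_apply, Complex.star_def, Complex.add_re,
    Complex.mul_re, Complex.conj_re, Complex.conj_im]
  ring

theorem nsq_adjugate (M : Matrix (Fin 2) (Fin 2) ℂ) : nsq M.adjugate = nsq M := by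
  simp [nsq, Matrix.adjugate_fin_two]
  ring

theorem nsq_inv (A : SL(2, ℂ)) : nsq (A⁻¹).1 = nsq A.1 := by
  rw [Matrix.SpecialLinearGroup.coe_inv]
  exact nsq_adjugate _

theorem det_normSq_le (M : Matrix (Fin 2) (Fin 2) ℂ) : 2 * ‖M.det‖ ≤ nsq M := by
  rw [Matrix.det_fin_two]
  have h := norm_sub_le (M 0 0 * M 1 1) (M 0 1 * M 1 0)
  simp only [norm_mul] at h
  simp only [nsq, Complex.normSq_eq_norm_sq]
  nlinarith [sq_nonneg (‖M 0 0‖ - ‖M 1 1‖), sq_nonneg (‖M 0 1‖ - ‖M 1 0‖)]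

theorem two_le_nsq (A : SL(2, ℂ)) : 2 ≤ nsq A.1 := by
  have := det_normSq_le A.1
  rw [A.2] at this
  simpa using this

/-- The element of `SL₂(ℂ)` with given entries. -/
def slMk (a b c d : ℂ) (h : a * d - b * c = 1) : SL(2, ℂ) :=
  ⟨!![a, b; c, d], by rw [Matrix.det_fin_two_of, h]⟩

theorem slMk_val (a b c d : ℂ) (h : a * d - b * c = 1) : (slMk a b c d h).1 = !![a, b; c, d] := rfl

namespace Hyp3

theorem coe_smul_origin (A : SL(2, ℂ)) : (A • origin).1 = A.1 * A.1ᴴ := by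
  rw [coe_smul]
  simp [origin]

/-- Explicit coordinates, in which the distance becomes a Lorentzian product and transitivity a
Cholesky factorisation. -/
theorem exists_entries (X : Hyp3) : ∃ (p q : ℝ) (z : ℂ), 0 < p ∧ p * q - Complex.normSq z = 1 ∧
    X.1 = !![(p : ℂ), z; star z, (q : ℂ)] := by
  obtain ⟨X, hX, hd⟩ := X
  have hH := hX.isHermitian
  have h0 := hX.diag_pos (i := 0)
  have h1 := hX.diag_pos (i := 1)
  rw [Complex.pos_iff] at h0 h1
  have e0 : X 0 0 = ((X 0 0).re : ℂ) := by apply Complex.ext <;> simp [← h0.2]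
  have e1 : X 1 1 = ((X 1 1).re : ℂ) := by apply Complex.ext <;> simp [← h1.2]
  have e2 : X 1 0 = star (X 0 1) := (hH.apply 1 0).symm
  refine ⟨(X 0 0).re, (X 1 1).re, X 0 1, h0.1, ?_, ?_⟩
  · rw [Matrix.det_fin_two, e0, e1, e2] at hd
    have := congrArg Complex.re hd
    simpa [Complex.normSq_apply] using this
  · ext i j
    fin_cases i <;> fin_cases j
    · exact e0
    · rfl
    · exact e2
    · exact e1

theorem exists_smul_origin (X : Hyp3) : ∃ A : SL(2, ℂ), A • origin = X := by
  obtain ⟨p, q, z, hp, hd, hX⟩ := exists_entries X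
  have hs : 0 < Real.sqrt p := Real.sqrt_pos.2 hp
  have hsc : ((Real.sqrt p : ℝ) : ℂ) ≠ 0 := by exact_mod_cast hs.ne'
  have hss : ((Real.sqrt p : ℝ) : ℂ) * (Real.sqrt p : ℝ) = p := by
    rw [← Complex.ofReal_mul, Real.mul_self_sqrt hp.le]
  have hpc : (p : ℂ) ≠ 0 := by exact_mod_cast hp.ne'
  have hd' : (p : ℂ) * q - star z * z = 1 := by
    rw [Complex.star_def, ← Complex.normSq_eq_conj_mul_self]
    exact_mod_cast hd
  -- The lower triangular Cholesky factor of `X`.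
  refine ⟨slMk (Real.sqrt p : ℝ) 0 (star z / (Real.sqrt p : ℝ)) (1 / (Real.sqrt p : ℝ)) ?_,
    Subtype.ext ?_⟩
  · simp [hsc]
  · rw [coe_smul_origin, hX, slMk_val]
    ext i j
    fin_cases i <;> fin_cases j
    · simp [Matrix.mul_apply, hss]
    · simp [Matrix.mul_apply]
      field_simp
    · simp [Matrix.mul_apply, div_mul_cancel₀ _ hsc]
    · simp [Matrix.mul_apply]
      rw [Complex.star_def] at hd'
      field_simp
      rw [pow_two, hss]
      linear_combination -hd'

theorem trace_inv_mul_smul (A : SL(2, ℂ)) (X Y : Hyp3) :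
    ((A • X).1⁻¹ * (A • Y).1).trace = (X.1⁻¹ * Y.1).trace := by
  rw [coe_smul, coe_smul]
  have hA : IsUnit A.1.det := by rw [A.2]; exact isUnit_one
  rw [Matrix.mul_inv_rev, Matrix.mul_inv_rev, Matrix.trace_mul_comm]
  have h1 : A.1 * Y.1 * A.1ᴴ * ((A.1ᴴ)⁻¹ * (X.1⁻¹ * A.1⁻¹)) = A.1 * (Y.1 * X.1⁻¹) * A.1⁻¹ := by
    have hA' : IsUnit (A.1ᴴ).det := by rw [Matrix.det_conjTranspose, A.2]; simp
    have := Matrix.mul_nonsing_inv _ hA'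
    calc _ = A.1 * Y.1 * (A.1ᴴ * (A.1ᴴ)⁻¹) * X.1⁻¹ * A.1⁻¹ := by simp only [Matrix.mul_assoc]
      _ = _ := by rw [this, mul_one]; simp only [Matrix.mul_assoc]
  rw [h1, Matrix.trace_mul_comm, ← Matrix.mul_assoc, Matrix.nonsing_inv_mul _ hA, one_mul,
    Matrix.trace_mul_comm]

theorem hdist_smul (A : SL(2, ℂ)) (X Y : Hyp3) : hdist (A • X) (A • Y) = hdist X Y := by
  unfold hdist
  rw [trace_inv_mul_smul]

theorem trace_inv_mul_smul_origin_re (A B : SL(2, ℂ)) :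
    ((A • origin).1⁻¹ * (B • origin).1).trace.re = nsq (A⁻¹ * B).1 := by
  rw [← mul_inv_cancel_left A B, mul_smul, trace_inv_mul_smul, mul_inv_cancel_left, coe_smul_origin]
  simp only [origin, inv_one, one_mul]
  rw [trace_mul_conjTranspose_re]

theorem one_le_trace_inv_mul (X Y : Hyp3) : 1 ≤ (X.1⁻¹ * Y.1).trace.re / 2 := by
  obtain ⟨A, rfl⟩ := exists_smul_origin X
  obtain ⟨B, rfl⟩ := exists_smul_origin Y
  rw [trace_inv_mul_smul_origin_re]
  linarith [two_le_nsq (A⁻¹ * B)]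

theorem hdist_origin_smul (A : SL(2, ℂ)) :
    hdist origin (A • origin) = Real.arcosh (nsq A.1 / 2) := by
  unfold hdist
  rw [coe_smul_origin]
  simp only [origin, inv_one, one_mul]
  rw [trace_mul_conjTranspose_re]

theorem hdist_smul_origin_smul_origin (A B : SL(2, ℂ)) :
    hdist (A • origin) (B • origin) = Real.arcosh (nsq (A⁻¹ * B).1 / 2) := by
  rw [hdist, trace_inv_mul_smul_origin_re]

theorem hdist_nonneg (X Y : Hyp3) : 0 ≤ hdist X Y :=
  Real.arcosh_nonneg (one_le_trace_inv_mul X Y)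

theorem hdist_comm (X Y : Hyp3) : hdist X Y = hdist Y X := by
  obtain ⟨A, rfl⟩ := exists_smul_origin X
  obtain ⟨B, rfl⟩ := exists_smul_origin Y
  rw [hdist_smul_origin_smul_origin, hdist_smul_origin_smul_origin, ← nsq_inv, mul_inv_rev, inv_inv]

theorem hdist_self (X : Hyp3) : hdist X X = 0 := by
  obtain ⟨A, rfl⟩ := exists_smul_origin X
  rw [hdist_smul]
  simp [hdist, origin]

theorem trace_inv_mul_re {p q p' q' : ℝ} {z z' : ℂ} (h : p * q - Complex.normSq z = 1) :
    ((!![(p : ℂ), z; star z, (q : ℂ)])⁻¹ * !![(p' : ℂ), z'; star z', (q' : ℂ)]).trace.re / 2 =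
      (p + q) / 2 * ((p' + q') / 2) -
        ((p - q) / 2 * ((p' - q') / 2) + z.re * z'.re + z.im * z'.im) := by
  have hd : (!![(p : ℂ), z; star z, (q : ℂ)]).det = 1 := by
    rw [Matrix.det_fin_two_of, Complex.star_def, Complex.mul_conj]
    exact_mod_cast h
  rw [Matrix.inv_def, hd, Ring.inverse_one, one_smul, Matrix.adjugate_fin_two_of]
  simp [Matrix.trace_fin_two]
  ring

/-- Split each matrix into half its trace, `s` or `t`, and a spatial vector of squared length `s ^ 2
- 1` or `t ^ 2 - 1`. Cauchy–Schwarz bounds the Lorentzian product by `s * t + √(s ^ 2 - 1) * √(t ^ 2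
- 1)`, which is `cosh` of the sum of the two distances to the origin. -/
theorem hdist_triangle_origin (X Y : Hyp3) : hdist X Y ≤ hdist X origin + hdist origin Y := by
  obtain ⟨p, q, z, hp, hd, hX⟩ := exists_entries X
  obtain ⟨p', q', z', hp', hd', hY⟩ := exists_entries Y
  have ho : origin.1 = !![((1 : ℝ) : ℂ), 0; star 0, ((1 : ℝ) : ℂ)] := by
    simp [origin, Matrix.one_fin_two]
  have hq : 0 < q := by
    have := Complex.normSq_nonneg z
    by_contra hq
    nlinarith
  have hq' : 0 < q' := by
    have := Complex.normSq_nonneg z'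
    by_contra hq
    nlinarith
  rw [Complex.normSq_apply] at hd hd'
  set s := (p + q) / 2 with hs
  set t := (p' + q') / 2 with ht
  have e1 : hdist X origin = Real.arcosh s := by
    rw [hdist, hX, ho, trace_inv_mul_re (by rw [Complex.normSq_apply]; exact hd)]
    simp [hs]
  have e2 : hdist origin Y = Real.arcosh t := by
    rw [hdist, hY, ho, trace_inv_mul_re (by simp)]
    simp [ht]
  have e3 : hdist X Y = Real.arcosh (s * t -
      ((p - q) / 2 * ((p' - q') / 2) + z.re * z'.re + z.im * z'.im)) := by
    rw [hdist, hX, hY, trace_inv_mul_re (by rw [Complex.normSq_apply]; exact hd)]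
  have hs2 : s ^ 2 - 1 = ((p - q) / 2) ^ 2 + z.re ^ 2 + z.im ^ 2 := by rw [hs]; linarith
  have ht2 : t ^ 2 - 1 = ((p' - q') / 2) ^ 2 + z'.re ^ 2 + z'.im ^ 2 := by rw [ht]; linarith
  have hs1 : 1 ≤ s := by
    have : 0 < s := by positivity
    nlinarith [sq_nonneg ((p - q) / 2), sq_nonneg z.re, sq_nonneg z.im]
  have ht1 : 1 ≤ t := by
    have : 0 < t := by positivity
    nlinarith [sq_nonneg ((p' - q') / 2), sq_nonneg z'.re, sq_nonneg z'.im]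
  have hnn : 0 ≤ Real.arcosh s + Real.arcosh t :=
    add_nonneg (Real.arcosh_nonneg hs1) (Real.arcosh_nonneg ht1)
  have hcs : |(p - q) / 2 * ((p' - q') / 2) + z.re * z'.re + z.im * z'.im| ≤
      √(s ^ 2 - 1) * √(t ^ 2 - 1) := by
    rw [← Real.sqrt_mul (by nlinarith)]
    apply Real.abs_le_sqrt
    rw [hs2, ht2]
    nlinarith [sq_nonneg ((p - q) / 2 * z'.re - (p' - q') / 2 * z.re),
      sq_nonneg ((p - q) / 2 * z'.im - (p' - q') / 2 * z.im),
      sq_nonneg (z.re * z'.im - z'.re * z.im)]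
  have hlt : √(s ^ 2 - 1) * √(t ^ 2 - 1) < s * t := by
    apply mul_lt_mul'' _ _ (Real.sqrt_nonneg _) (Real.sqrt_nonneg _)
    · rw [Real.sqrt_lt' (by linarith)]; linarith
    · rw [Real.sqrt_lt' (by linarith)]; linarith
  rw [e1, e2, e3, ← Real.arcosh_cosh hnn, Real.arcosh_le_arcosh _ (Real.cosh_pos _), Real.cosh_add,
    Real.cosh_arcosh hs1, Real.cosh_arcosh ht1, Real.sinh_arcosh hs1, Real.sinh_arcosh ht1]
  · linarith [neg_abs_le ((p - q) / 2 * ((p' - q') / 2) + z.re * z'.re + z.im * z'.im)]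
  · linarith [le_abs_self ((p - q) / 2 * ((p' - q') / 2) + z.re * z'.re + z.im * z'.im)]

theorem hdist_triangle (X Y Z : Hyp3) : hdist X Z ≤ hdist X Y + hdist Y Z := by
  obtain ⟨A, rfl⟩ := exists_smul_origin Y
  have := hdist_triangle_origin (A⁻¹ • X) (A⁻¹ • Z)
  rw [hdist_smul] at this
  rw [← hdist_smul A⁻¹ X (A • origin), ← hdist_smul A⁻¹ (A • origin) Z, inv_smul_smul]
  exact this

end Hyp3

theorem isCompact_nsq_le (c : ℝ) :
    IsCompact {M : Matrix (Fin 2) (Fin 2) ℂ | M.det = 1 ∧ nsq M ≤ c} := by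
  have hK : IsCompact (Set.pi Set.univ fun _ : Fin 2 => Set.pi Set.univ fun _ : Fin 2 =>
      Metric.closedBall (0 : ℂ) (1 + c)) :=
    isCompact_univ_pi fun _ => isCompact_univ_pi fun _ => isCompact_closedBall _ _
  refine IsCompact.of_isClosed_subset hK ?_ ?_
  · have h1 : IsClosed {M : Matrix (Fin 2) (Fin 2) ℂ | M.det = 1} :=
      isClosed_eq (by fun_prop) continuous_const
    have hc : Continuous nsq := by
      have := Complex.continuous_normSq
      unfold nsq
      fun_prop
    exact h1.inter (isClosed_le hc continuous_const)
  · rintro M ⟨-, hM⟩ i - j -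
    have h0 := Complex.normSq_nonneg
    have h1 : Complex.normSq (M i j) ≤ c := by
      refine le_trans ?_ hM
      unfold nsq
      fin_cases i <;> fin_cases j <;> simp <;>
        linarith [h0 (M 0 0), h0 (M 0 1), h0 (M 1 0), h0 (M 1 1)]
    rw [Complex.normSq_eq_norm_sq] at h1
    rw [mem_closedBall_zero_iff]
    nlinarith [sq_nonneg (‖M i j‖ - 1), norm_nonneg (M i j)]

theorem Hyp3.isCompact_closedBall_origin (R : ℝ) :
    IsCompact {X : Hyp3 | Hyp3.hdist Hyp3.origin X ≤ R} := by
  -- The value `0` for `R < 0` makes the right side empty, as it must be, because `nsq` is at least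
  -- `2` on `SL(2, ℂ)`.
  have hset : Subtype.val '' {X : Hyp3 | Hyp3.hdist Hyp3.origin X ≤ R} =
      (fun M : Matrix (Fin 2) (Fin 2) ℂ => M * Mᴴ) ''
        {M | M.det = 1 ∧ nsq M ≤ if 0 ≤ R then 2 * Real.cosh R else 0} := by
    have key : ∀ A : SL(2, ℂ), Hyp3.hdist Hyp3.origin (A • Hyp3.origin) ≤ R ↔
        nsq A.1 ≤ if 0 ≤ R then 2 * Real.cosh R else 0 := by
      intro A
      have h2 := two_le_nsq A
      split_ifs with hR
      · rw [Hyp3.hdist_origin_smul, ← Real.arcosh_cosh hR,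
          Real.arcosh_le_arcosh (by linarith) (Real.cosh_pos _), Real.arcosh_cosh hR]
        constructor <;> intro h <;> linarith
      · constructor
        · intro h
          linarith [Hyp3.hdist_nonneg Hyp3.origin (A • Hyp3.origin)]
        · intro h
          linarith
    ext M
    constructor
    · rintro ⟨X, hX, rfl⟩
      obtain ⟨A, rfl⟩ := Hyp3.exists_smul_origin X
      exact ⟨A.1, ⟨A.2, (key A).1 hX⟩, (Hyp3.coe_smul_origin A).symm⟩
    · rintro ⟨N, ⟨hd, hN⟩, rfl⟩
      let A : SL(2, ℂ) := ⟨N, hd⟩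
      exact ⟨A • Hyp3.origin, (key A).2 hN, Hyp3.coe_smul_origin A⟩
  rw [Subtype.isCompact_iff, hset]
  exact (isCompact_nsq_le _).image (by fun_prop)

/-! ### Displacement and stable translation length -/

/-- The displacement of the base point of `ℍ³` under `A`. -/
noncomputable def disp (A : SL(2, ℂ)) : ℝ := Hyp3.hdist Hyp3.origin (A • Hyp3.origin)

theorem disp_eq (A : SL(2, ℂ)) : disp A = Real.arcosh (nsq A.1 / 2) := Hyp3.hdist_origin_smul A

theorem disp_nonneg (A : SL(2, ℂ)) : 0 ≤ disp A := Hyp3.hdist_nonneg _ _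

theorem cosh_disp (A : SL(2, ℂ)) : Real.cosh (disp A) = nsq A.1 / 2 := by
  rw [disp_eq, Real.cosh_arcosh (by linarith [two_le_nsq A])]

theorem disp_mul_le (A B : SL(2, ℂ)) : disp (A * B) ≤ disp A + disp B := by
  have := Hyp3.hdist_triangle Hyp3.origin (A • Hyp3.origin) ((A * B) • Hyp3.origin)
  rwa [mul_smul, Hyp3.hdist_smul, ← mul_smul] at this

theorem disp_one : disp 1 = 0 := by
  rw [disp, one_smul, Hyp3.hdist_self]

theorem disp_inv (A : SL(2, ℂ)) : disp A⁻¹ = disp A := by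
  rw [disp_eq, nsq_inv, ← disp_eq]

theorem nsq_le_two_mul_exp_disp (A : SL(2, ℂ)) : nsq A.1 ≤ 2 * Real.exp (disp A) := by
  have h := cosh_disp A
  rw [Real.cosh_eq] at h
  have : Real.exp (-disp A) ≤ Real.exp (disp A) :=
    Real.exp_le_exp.2 (by linarith [disp_nonneg A])
  linarith

theorem disp_le_log_nsq (A : SL(2, ℂ)) : disp A ≤ Real.log (nsq A.1) := by
  have h := cosh_disp A
  rw [Real.cosh_eq] at h
  rw [Real.le_log_iff_exp_le (by linarith [two_le_nsq A])]
  linarith [Real.exp_pos (-disp A)]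

theorem subadditive_disp_pow (A : SL(2, ℂ)) : Subadditive fun k : ℕ => disp (A ^ k) := by
  intro m n
  simp only [pow_add]
  exact disp_mul_le _ _

theorem bddBelow_disp_pow (A : SL(2, ℂ)) :
    BddBelow (Set.range fun k : ℕ => disp (A ^ k) / k) := by
  refine ⟨0, ?_⟩
  rintro _ ⟨k, rfl⟩
  exact div_nonneg (disp_nonneg _) (Nat.cast_nonneg _)

/-- The stable translation length on `ℍ³` of an element of `SL₂(ℂ)`. -/
noncomputable def stableLength (A : SL(2, ℂ)) : ℝ := (subadditive_disp_pow A).lim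

theorem tendsto_stableLength (A : SL(2, ℂ)) :
    Tendsto (fun k : ℕ => disp (A ^ k) / k) atTop (𝓝 (stableLength A)) :=
  (subadditive_disp_pow A).tendsto_lim (bddBelow_disp_pow A)

theorem stableLength_nonneg (A : SL(2, ℂ)) : 0 ≤ stableLength A :=
  ge_of_tendsto' (tendsto_stableLength A) fun _ => div_nonneg (disp_nonneg _) (Nat.cast_nonneg _)

theorem stableLength_le_disp (A : SL(2, ℂ)) : stableLength A ≤ disp A := by
  have := (subadditive_disp_pow A).lim_le_div (bddBelow_disp_pow A) one_ne_zero
  simpa [stableLength] using this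

theorem stableLength_pow (A : SL(2, ℂ)) (m : ℕ) : stableLength (A ^ m) = m * stableLength A := by
  rcases Nat.eq_zero_or_pos m with rfl | hm
  · have h := stableLength_le_disp 1
    rw [disp_one] at h
    simpa using le_antisymm h (stableLength_nonneg 1)
  · have h1 := tendsto_stableLength (A ^ m)
    have h2 : Tendsto (fun k : ℕ => m * (disp (A ^ (m * k)) / ((m * k : ℕ) : ℝ))) atTop
        (𝓝 (m * stableLength A)) :=
      ((tendsto_stableLength A).comp (tendsto_id.const_mul_atTop' hm)).const_mul _
    refine tendsto_nhds_unique h1 (h2.congr fun k => ?_)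
    have hm' : (m : ℝ) ≠ 0 := by exact_mod_cast hm.ne'
    rw [pow_mul]
    push_cast
    field_simp

/-- Conjugation changes the displacement of every power by at most `2 * disp B`, which disappears
after division by the exponent. -/
theorem stableLength_conj_le (A B : SL(2, ℂ)) :
    stableLength (B * A * B⁻¹) ≤ stableLength A := by
  have h1 := tendsto_stableLength (B * A * B⁻¹)
  have h2 : Tendsto (fun k : ℕ => disp (A ^ k) / k + 2 * disp B / k) atTop
      (𝓝 (stableLength A + 0)) :=
    (tendsto_stableLength A).add (tendsto_const_div_atTop_nhds_zero_nat _)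
  rw [add_zero] at h2
  refine le_of_tendsto_of_tendsto' h1 h2 fun k => ?_
  rw [← add_div, conj_pow]
  refine div_le_div_of_nonneg_right ?_ (Nat.cast_nonneg _)
  have := disp_mul_le (B * A ^ k) B⁻¹
  have := disp_mul_le B (A ^ k)
  rw [disp_inv] at *
  linarith

theorem stableLength_conj (A B : SL(2, ℂ)) : stableLength (B * A * B⁻¹) = stableLength A := by
  refine le_antisymm (stableLength_conj_le A B) ?_
  have := stableLength_conj_le (B * A * B⁻¹) B⁻¹
  rwa [show B⁻¹ * (B * A * B⁻¹) * B⁻¹⁻¹ = A by group] at this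

theorem stableLength_le_hdist (A : SL(2, ℂ)) (X : Hyp3) :
    stableLength A ≤ Hyp3.hdist X (A • X) := by
  obtain ⟨B, rfl⟩ := Hyp3.exists_smul_origin X
  have h := stableLength_le_disp (B⁻¹ * A * B)
  have h' := stableLength_conj A B⁻¹
  rw [inv_inv] at h'
  rwa [h', disp, mul_assoc, mul_smul, ← Hyp3.hdist_smul B, smul_inv_smul, mul_smul] at h

/-! ### Triangular normal forms, and traces versus length -/

/-- The upper triangular element of `SL₂(ℂ)` with diagonal `μ, μ⁻¹`. -/
noncomputable def slTri (μ b : ℂ) (hμ : μ ≠ 0) : SL(2, ℂ) := slMk μ b 0 μ⁻¹ (by simp [hμ])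

theorem slTri_val (μ b : ℂ) (hμ : μ ≠ 0) : (slTri μ b hμ).1 = !![μ, b; 0, μ⁻¹] := rfl

theorem slTri_pow (μ b : ℂ) (hμ : μ ≠ 0) (k : ℕ) :
    ∃ b', ((slTri μ b hμ) ^ k).1 = !![μ ^ k, b'; 0, (μ⁻¹) ^ k] := by
  induction k with
  | zero => exact ⟨0, by simp [Matrix.one_fin_two]⟩
  | succ k ih =>
    obtain ⟨b', hb⟩ := ih
    refine ⟨μ ^ k * b + b' * μ⁻¹, ?_⟩
    rw [pow_succ, Matrix.SpecialLinearGroup.coe_mul]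
    change ((slTri μ b hμ) ^ k).1 * (slTri μ b hμ).1 = _
    rw [hb, slTri_val]
    simp [pow_succ]

/-- The diagonal of the `k`-th power alone forces `nsq` to be at least `‖μ‖ ^ (2 * k)` and its
inverse; the factor `2` between `nsq` and `exp (disp)` costs `log 2 / k`. -/
theorem le_stableLength_slTri (μ b : ℂ) (hμ : μ ≠ 0) :
    2 * |Real.log ‖μ‖| ≤ stableLength (slTri μ b hμ) := by
  have hlim : Tendsto (fun k : ℕ => 2 * |Real.log ‖μ‖| - Real.log 2 / k) atTop
      (𝓝 (2 * |Real.log ‖μ‖| - 0)) :=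
    tendsto_const_nhds.sub (tendsto_const_div_atTop_nhds_zero_nat _)
  rw [sub_zero] at hlim
  refine le_of_tendsto_of_tendsto hlim (tendsto_stableLength _) ?_
  filter_upwards [eventually_gt_atTop 0] with k hk
  have hk' : (0 : ℝ) < k := by exact_mod_cast hk
  obtain ⟨b', hb⟩ := slTri_pow μ b hμ k
  have hn := nsq_le_two_mul_exp_disp (slTri μ b hμ ^ k)
  have hμ' : 0 < ‖μ‖ := norm_pos_iff.2 hμ
  have key : Real.exp (2 * k * |Real.log ‖μ‖|) ≤ 2 * Real.exp (disp (slTri μ b hμ ^ k)) := by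
    refine le_trans ?_ hn
    rw [hb]
    simp only [nsq, Matrix.of_apply, Matrix.cons_val', Matrix.cons_val_zero, Matrix.cons_val_one,
      Matrix.cons_val_fin_one, Complex.normSq_eq_norm_sq, norm_pow, norm_inv]
    have h1 : Real.exp (2 * k * |Real.log ‖μ‖|) = (‖μ‖ ^ k) ^ 2 ∨
        Real.exp (2 * k * |Real.log ‖μ‖|) = (‖μ‖⁻¹ ^ k) ^ 2 := by
      rcases abs_choice (Real.log ‖μ‖) with h | h
      · left
        rw [h, ← pow_mul, ← Real.exp_log hμ', ← Real.exp_nat_mul, Real.exp_log hμ']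
        push_cast
        ring_nf
      · right
        rw [h, ← pow_mul, ← Real.log_inv, ← Real.exp_log (inv_pos.2 hμ'), ← Real.exp_nat_mul,
          Real.exp_log (inv_pos.2 hμ')]
        push_cast
        ring_nf
    rcases h1 with h | h <;> rw [h] <;> nlinarith [sq_nonneg ‖b'‖, sq_nonneg ‖(0 : ℂ)‖,
      sq_nonneg (‖μ‖ ^ k), sq_nonneg (‖μ‖⁻¹ ^ k)]
  have := Real.log_le_log (Real.exp_pos _) key
  rw [Real.log_exp, Real.log_mul two_ne_zero (Real.exp_pos _).ne', Real.log_exp] at this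
  rw [sub_le_iff_le_add, ← add_div, le_div_iff₀ hk']
  linarith

theorem disp_slTri_zero (μ : ℂ) (hμ : μ ≠ 0) : disp (slTri μ 0 hμ) = 2 * |Real.log ‖μ‖| := by
  have hμ' : 0 < ‖μ‖ := norm_pos_iff.2 hμ
  have h1 : nsq (slTri μ 0 hμ).1 / 2 = Real.cosh (2 * |Real.log ‖μ‖|) := by
    rw [show 2 * |Real.log ‖μ‖| = |2 * Real.log ‖μ‖| by simp [abs_mul], Real.cosh_abs,
      Real.cosh_eq, two_mul, neg_add, Real.exp_add, Real.exp_add, Real.exp_neg, Real.exp_log hμ']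
    simp [slTri_val, nsq, Complex.normSq_eq_norm_sq, pow_two]
  rw [disp_eq, h1, Real.arcosh_cosh (by positivity)]

theorem stableLength_slTri_zero (μ : ℂ) (hμ : μ ≠ 0) :
    stableLength (slTri μ 0 hμ) = 2 * |Real.log ‖μ‖| :=
  le_antisymm ((stableLength_le_disp _).trans_eq (disp_slTri_zero μ hμ))
    (le_stableLength_slTri μ 0 hμ)

theorem exists_conj_slTri (A : SL(2, ℂ)) :
    ∃ (h : SL(2, ℂ)) (μ b : ℂ) (hμ : μ ≠ 0), A = h * slTri μ b hμ * h⁻¹ := by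
  obtain ⟨a, b, c, d, hd, rfl⟩ : ∃ (a b c d : ℂ) (hd : a * d - b * c = 1), A = slMk a b c d hd :=
    ⟨A.1 0 0, A.1 0 1, A.1 1 0, A.1 1 1, by rw [← Matrix.det_fin_two, A.2],
      Subtype.ext (Matrix.eta_fin_two A.1)⟩
  by_cases hc : c = 0
  · subst hc
    have ha : a ≠ 0 := by rintro rfl; simp at hd
    have hd' : d = a⁻¹ := eq_inv_of_mul_eq_one_right (by simpa using hd)
    subst hd'
    exact ⟨1, a, b, ha, by simp [slTri]⟩
  · obtain ⟨s, hs⟩ := IsAlgClosed.exists_pow_nat_eq ((a + d) ^ 2 - 4) (n := 2) (by norm_num)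
    set μ := (a + d + s) / 2 with hμdef
    have hμ : μ ^ 2 - (a + d) * μ + 1 = 0 := by rw [hμdef]; linear_combination hs / 4
    have hμ0 : μ ≠ 0 := by intro h; rw [h] at hμ; simp at hμ
    have hinv : μ⁻¹ = a + d - μ := by
      refine inv_eq_of_mul_eq_one_right ?_
      linear_combination -hμ
    -- The first column is an eigenvector for `μ`; the second completes it to determinant one.
    refine ⟨slMk (μ - d) (-c⁻¹) c 0 (by field_simp; ring), μ, -c⁻¹, hμ0, ?_⟩
    rw [eq_mul_inv_iff_mul_eq]
    apply Subtype.ext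
    change !![a, b; c, d] * !![μ - d, -c⁻¹; c, 0] =
      !![μ - d, -c⁻¹; c, 0] * !![μ, -c⁻¹; 0, μ⁻¹]
    rw [hinv, Matrix.mul_fin_two, Matrix.mul_fin_two]
    ext i j
    fin_cases i <;> fin_cases j <;> simp <;> first | ring1 | skip
    · linear_combination -hμ - hd

/-- When `μ` and `μ⁻¹` differ, a unipotent shear removes the off-diagonal entry. -/
theorem exists_conj_slTri_zero_or_parabolic (A : SL(2, ℂ)) :
    (∃ (h : SL(2, ℂ)) (μ : ℂ) (hμ : μ ≠ 0), A = h * slTri μ 0 hμ * h⁻¹) ∨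
    ∃ (h : SL(2, ℂ)) (μ b : ℂ) (hμ : μ ≠ 0), μ ^ 2 = 1 ∧ b ≠ 0 ∧ A = h * slTri μ b hμ * h⁻¹ := by
  obtain ⟨h, μ, b, hμ, hA⟩ := exists_conj_slTri A
  by_cases hb : b = 0
  · subst hb
    exact Or.inl ⟨h, μ, hμ, hA⟩
  by_cases h1 : μ ^ 2 = 1
  · exact Or.inr ⟨h, μ, b, hμ, h1, hb, hA⟩
  · left
    have hne : μ⁻¹ - μ ≠ 0 := by
      intro h0
      apply h1
      field_simp at h0
      linear_combination -h0
    set t := b / (μ⁻¹ - μ) with ht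
    let U : SL(2, ℂ) := slMk 1 t 0 1 (by simp)
    have hU : slTri μ b hμ = U * slTri μ 0 hμ * U⁻¹ := by
      rw [eq_mul_inv_iff_mul_eq]
      apply Subtype.ext
      change !![μ, b; 0, μ⁻¹] * !![1, t; 0, 1] = !![1, t; 0, 1] * !![μ, 0; 0, μ⁻¹]
      have : t * (μ⁻¹ - μ) = b := by rw [ht]; field_simp
      ext i j
      fin_cases i <;> fin_cases j <;> simp
      linear_combination -this
    refine ⟨h * U, μ, hμ, ?_⟩
    rw [hA, hU]
    group

/-- The eigenvalues are `μ` and `μ⁻¹`, and `|log ‖μ‖|` is at most half the stable length. -/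
theorem norm_trace_le (A : SL(2, ℂ)) : ‖A.1.trace‖ ≤ 2 * Real.exp (stableLength A / 2) := by
  obtain ⟨h, μ, b, hμ, rfl⟩ := exists_conj_slTri A
  rw [stableLength_conj]
  have h1 : (h * slTri μ b hμ * h⁻¹).1.trace = μ + μ⁻¹ := by
    rw [Matrix.SpecialLinearGroup.coe_mul, Matrix.trace_mul_comm,
      ← Matrix.SpecialLinearGroup.coe_mul, inv_mul_cancel_left, ← Matrix.trace_fin_two_of μ b 0 μ⁻¹]
    rfl
  rw [h1]
  have hμ' : 0 < ‖μ‖ := norm_pos_iff.2 hμ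
  have h2 := le_stableLength_slTri μ b hμ
  have h3 : ‖μ‖ ≤ Real.exp (stableLength (slTri μ b hμ) / 2) := by
    rw [← Real.log_le_iff_le_exp hμ']
    linarith [le_abs_self (Real.log ‖μ‖)]
  have h4 : ‖μ‖⁻¹ ≤ Real.exp (stableLength (slTri μ b hμ) / 2) := by
    rw [← Real.log_le_iff_le_exp (inv_pos.2 hμ'), Real.log_inv]
    linarith [neg_abs_le (Real.log ‖μ‖)]
  have h5 := norm_add_le μ μ⁻¹
  rw [norm_inv] at h5
  linarith

/-! ### Simultaneous conjugation to small norm -/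

/-- The traceless matrix with given coordinates in the basis of Pauli matrices. -/
noncomputable def pauli (v : Fin 3 → ℂ) : Matrix (Fin 2) (Fin 2) ℂ :=
  !![v 2, v 0 - Complex.I * v 1; v 0 + Complex.I * v 1, -v 2]

theorem nsq_pauli (v : Fin 3 → ℂ) : nsq (pauli v) = 2 * ∑ p, Complex.normSq (v p) := by
  simp [nsq, pauli, Complex.normSq_apply, Fin.sum_univ_three]
  ring

theorem trace_pauli_mul_pauli (v w : Fin 3 → ℂ) : (pauli v * pauli w).trace = 2 * ∑ p, v p * w p := by
  simp [pauli, Matrix.trace_fin_two, Fin.sum_univ_three]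
  linear_combination (-2 * v 1 * w 1) * Complex.I_mul_I

theorem exists_eq_pauli {M : Matrix (Fin 2) (Fin 2) ℂ} (hM : M.trace = 0) : ∃ v, M = pauli v := by
  refine ⟨![(M 0 1 + M 1 0) / 2, Complex.I * (M 0 1 - M 1 0) / 2, M 0 0], ?_⟩
  have h : M 1 1 = -M 0 0 := by rw [Matrix.trace_fin_two] at hM; linear_combination hM
  ext i j
  fin_cases i <;> fin_cases j <;> simp [pauli, h]
  · linear_combination ((M 0 1 - M 1 0) / 2) * Complex.I_mul_I
  · linear_combination (-(M 0 1 - M 1 0) / 2) * Complex.I_mul_I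

theorem pauli_sum (c : Fin 3 → ℂ) (w : Fin 3 → Fin 3 → ℂ) :
    pauli (∑ i, c i • w i) = ∑ i, c i • pauli (w i) := by
  ext i j
  fin_cases i <;> fin_cases j <;> simp [pauli, Fin.sum_univ_three] <;> ring

theorem normSq_sum_three_le (x : Fin 3 → ℂ) :
    Complex.normSq (∑ i, x i) ≤ 3 * ∑ i, Complex.normSq (x i) := by
  simp only [Fin.sum_univ_three, Complex.normSq_apply, Complex.add_re, Complex.add_im]
  nlinarith [sq_nonneg ((x 0).re - (x 1).re), sq_nonneg ((x 0).re - (x 2).re),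
    sq_nonneg ((x 1).re - (x 2).re), sq_nonneg ((x 0).im - (x 1).im),
    sq_nonneg ((x 0).im - (x 2).im), sq_nonneg ((x 1).im - (x 2).im)]

theorem nsq_sum_smul_le (c : Fin 3 → ℂ) (M : Fin 3 → Matrix (Fin 2) (Fin 2) ℂ) :
    nsq (∑ i, c i • M i) ≤ 3 * ∑ i, Complex.normSq (c i) * nsq (M i) := by
  have h : ∀ a b, Complex.normSq ((∑ i, c i • M i) a b) ≤
      3 * ∑ i, Complex.normSq (c i) * Complex.normSq (M i a b) := by
    intro a b
    have := normSq_sum_three_le fun i => c i * M i a b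
    simpa only [Matrix.sum_apply, Matrix.smul_apply, smul_eq_mul, map_mul] using this
  have := h 0 0
  have := h 0 1
  have := h 1 0
  have := h 1 1
  simp only [nsq, Fin.sum_univ_three] at *
  linarith

theorem nsq_add_le (M N : Matrix (Fin 2) (Fin 2) ℂ) : nsq (M + N) ≤ 2 * nsq M + 2 * nsq N := by
  have h : ∀ a b : ℂ, Complex.normSq (a + b) ≤ 2 * Complex.normSq a + 2 * Complex.normSq b := by
    intro a b
    simp only [Complex.normSq_apply, Complex.add_re, Complex.add_im]
    nlinarith [sq_nonneg (a.re - b.re), sq_nonneg (a.im - b.im)]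
  simp only [nsq, Matrix.add_apply]
  linarith [h (M 0 0) (N 0 0), h (M 0 1) (N 0 1), h (M 1 0) (N 1 0), h (M 1 1) (N 1 1)]

/-- With `R p q = ∑ i, u i p * star (u i q)`, the sum of squared moduli of the Gram entries equals
`∑ R p q ^ 2` without conjugates. When `R` is real this is a sum of nonnegative terms that includes
the squared diagonal, so the Gram entries bound the trace of `R`, which is half the total norm. -/
theorem sum_nsq_le_of_moment_eq_zero {u : Fin 3 → Fin 3 → ℂ} {β : ℝ}
    (hu : ∀ p q, (∑ i, u i p * star (u i q)).im = 0)
    (hβ : ∀ i j, ‖∑ p, u i p * u j p‖ ≤ β) : ∑ i, nsq (pauli (u i)) ≤ 32 / 3 * β := by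
  have hβ0 : 0 ≤ β := (norm_nonneg _).trans (hβ 0 0)
  set R : Fin 3 → Fin 3 → ℂ := fun p q => ∑ i, u i p * star (u i q) with hR
  have hsum : (((∑ i, ∑ j, ‖∑ p, u i p * u j p‖ ^ 2 : ℝ)) : ℂ) = ∑ p, ∑ q, R p q ^ 2 := by
    push_cast
    have h1 : ∀ i j, ((‖∑ p, u i p * u j p‖ : ℂ)) ^ 2 =
        ∑ p, ∑ q, (u i p * star (u i q)) * (u j p * star (u j q)) := by
      intro i j
      rw [← Complex.mul_conj', map_sum, Finset.sum_mul_sum]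
      refine Finset.sum_congr rfl fun p _ => Finset.sum_congr rfl fun q _ => ?_
      simp only [map_mul, Complex.star_def]
      ring
    simp_rw [h1]
    simp only [hR, Fin.sum_univ_three]
    ring
  have hRre : ∀ p q, R p q = ((R p q).re : ℂ) := fun p q =>
    Complex.ext rfl (by rw [Complex.ofReal_im]; exact hu p q)
  have hsum' : ∑ i, ∑ j, ‖∑ p, u i p * u j p‖ ^ 2 = ∑ p, ∑ q, (R p q).re ^ 2 := by
    have : (((∑ i, ∑ j, ‖∑ p, u i p * u j p‖ ^ 2 : ℝ)) : ℂ) =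
        ((∑ p, ∑ q, (R p q).re ^ 2 : ℝ) : ℂ) := by
      rw [hsum]
      push_cast
      exact Finset.sum_congr rfl fun p _ => Finset.sum_congr rfl fun q _ => by rw [← hRre]
    exact_mod_cast this
  have hle : ∑ i, ∑ j, ‖∑ p, u i p * u j p‖ ^ 2 ≤ 9 * β ^ 2 := by
    calc _ ≤ ∑ i : Fin 3, ∑ j : Fin 3, β ^ 2 :=
          Finset.sum_le_sum fun i _ => Finset.sum_le_sum fun j _ =>
            pow_le_pow_left₀ (norm_nonneg _) (hβ i j) 2
      _ = 9 * β ^ 2 := by simp; ring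
  have hdiag : ∀ p, (R p p).re = ∑ i, Complex.normSq (u i p) := by
    intro p
    simp [hR, Complex.normSq_apply]
  have htot : ∑ i, nsq (pauli (u i)) = 2 * ∑ p, (R p p).re := by
    simp_rw [nsq_pauli, hdiag, ← Finset.mul_sum]
    rw [Finset.sum_comm]
  have hnn : ∀ p, 0 ≤ (R p p).re := fun p => by
    rw [hdiag]
    exact Finset.sum_nonneg fun _ _ => Complex.normSq_nonneg _
  rw [htot]
  rw [hsum'] at hle
  simp only [Fin.sum_univ_three] at hle ⊢
  have h27 : ((R 0 0).re + (R 1 1).re + (R 2 2).re) ^ 2 ≤ 27 * β ^ 2 := by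
    nlinarith [sq_nonneg ((R 0 0).re - (R 1 1).re), sq_nonneg ((R 0 0).re - (R 2 2).re),
      sq_nonneg ((R 1 1).re - (R 2 2).re), sq_nonneg (R 0 1).re, sq_nonneg (R 0 2).re,
      sq_nonneg (R 1 0).re, sq_nonneg (R 1 2).re, sq_nonneg (R 2 0).re, sq_nonneg (R 2 1).re]
  -- Here `16 / 3` is a rational upper bound for `√27`.
  have := abs_le_of_sq_le_sq (a := (R 0 0).re + (R 1 1).re + (R 2 2).re) (b := 16 / 3 * β)
    (by nlinarith [sq_nonneg β]) (by positivity)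
  linarith [(abs_le.1 this).2]

/-- A triple of vectors in `ℂ³ ≅ 𝔰𝔩₂(ℂ)` that has the least norm in its `SL₂(ℂ)`-orbit. -/
def IsMinimalTriple (v : Fin 3 → Fin 3 → ℂ) : Prop :=
  ∀ h : SL(2, ℂ), ∑ i, nsq (pauli (v i)) ≤ ∑ i, nsq (h.1 * pauli (v i) * (h⁻¹).1)

/-- The function `p * s + q / s` has its minimum over `s > 0` at `s = 1`, where its derivative is `p
- q`; one explicit test value of `s` replaces the derivative. -/
theorem eq_of_add_le_mul_add_div {p q : ℝ} (hp : 0 ≤ p) (hq : 0 ≤ q)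
    (h : ∀ s : ℝ, 0 < s → p + q ≤ p * s + q / s) : p = q := by
  rcases eq_or_lt_of_le (add_nonneg hp hq) with h0 | h0
  · linarith
  have hs : 0 < 1 + (q - p) / (2 * (p + q)) := by
    rw [← sub_lt_iff_lt_add', zero_sub, lt_div_iff₀ (by positivity)]
    linarith
  set s := 1 + (q - p) / (2 * (p + q)) with hsdef
  have h1 := h s hs
  have h2 : 0 ≤ (s - 1) * (p * s - q) := by
    have := mul_le_mul_of_nonneg_right h1 hs.le
    rw [add_mul, add_mul, div_mul_cancel₀ _ hs.ne'] at this
    nlinarith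
  have h3 : (s - 1) * (2 * (p + q)) = q - p := by
    rw [hsdef]; field_simp; ring
  have h4 : s = 1 + (s - 1) := by ring
  set e := s - 1
  rw [h4] at h2
  have h5 : q - p = 2 * e * (p + q) := by linarith
  have h6 : 0 ≤ e ^ 2 * (p - 2 * (p + q)) := by nlinarith
  have h7 : e ^ 2 * (p + q) ≤ 0 := by nlinarith [mul_nonneg (sq_nonneg e) hq]
  have h8 : e ^ 2 = 0 := by nlinarith [sq_nonneg e]
  have h9 : e = 0 := by simpa using h8
  rw [h9] at h5
  linarith

/-- Minimality along the diagonal subgroup: conjugation by `diag (t, t⁻¹)` scales the two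
off-diagonal contributions by `t ^ 4` and `t ^ (-4)`, so they must agree, and their difference is a
multiple of the imaginary part in question. -/
theorem IsMinimalTriple.im_eq_zero {v : Fin 3 → Fin 3 → ℂ} (hv : IsMinimalTriple v) :
    (∑ i, v i 0 * star (v i 1)).im = 0 := by
  have key : ∑ i, Complex.normSq (v i 0 - Complex.I * v i 1) =
      ∑ i, Complex.normSq (v i 0 + Complex.I * v i 1) := by
    refine eq_of_add_le_mul_add_div (Finset.sum_nonneg fun _ _ => Complex.normSq_nonneg _)
      (Finset.sum_nonneg fun _ _ => Complex.normSq_nonneg _) fun s hs => ?_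
    have ht : 0 < √√s := Real.sqrt_pos.2 (Real.sqrt_pos.2 hs)
    have ht4 : √√s ^ 4 = s := by
      rw [show 4 = 2 * 2 by norm_num, pow_mul, Real.sq_sqrt (Real.sqrt_nonneg _), Real.sq_sqrt hs.le]
    set t := √√s
    have htc : (t : ℂ) ≠ 0 := by exact_mod_cast ht.ne'
    have h := hv (slTri t 0 htc)
    have h1 : ∀ i, nsq ((slTri t 0 htc).1 * pauli (v i) * ((slTri t 0 htc)⁻¹).1) =
        2 * Complex.normSq (v i 2) + Complex.normSq (v i 0 - Complex.I * v i 1) * s +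
          Complex.normSq (v i 0 + Complex.I * v i 1) / s := by
      intro i
      have hM : (slTri t 0 htc).1 * pauli (v i) * ((slTri t 0 htc)⁻¹).1 =
          !![v i 2, (t ^ 2 : ℂ) * (v i 0 - Complex.I * v i 1);
            ((t ^ 2 : ℂ))⁻¹ * (v i 0 + Complex.I * v i 1), - v i 2] := by
        rw [Matrix.SpecialLinearGroup.coe_inv]
        change !![(t : ℂ), 0; 0, (t : ℂ)⁻¹] * pauli (v i) * (!![(t : ℂ), 0; 0, (t : ℂ)⁻¹]).adjugate = _
        rw [Matrix.adjugate_fin_two_of]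
        ext i j
        fin_cases i <;> fin_cases j <;> simp [pauli] <;> field_simp
      rw [hM]
      have e1 : Complex.normSq ((t : ℂ) ^ 2) = s := by
        rw [← ht4, map_pow, Complex.normSq_ofReal]; ring
      simp only [nsq, Matrix.of_apply, Matrix.cons_val', Matrix.cons_val_zero, Matrix.cons_val_one,
        Matrix.cons_val_fin_one, map_mul, map_inv₀, e1, Complex.normSq_neg]
      ring
    have h2 : ∀ i, nsq (pauli (v i)) = 2 * Complex.normSq (v i 2) +
        Complex.normSq (v i 0 - Complex.I * v i 1) +
          Complex.normSq (v i 0 + Complex.I * v i 1) := by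
      intro i
      simp only [nsq, pauli, Matrix.of_apply, Matrix.cons_val', Matrix.cons_val_zero,
        Matrix.cons_val_one, Matrix.cons_val_fin_one, Complex.normSq_neg]
      ring
    simp_rw [h1, h2, Finset.sum_add_distrib, ← Finset.sum_mul, ← Finset.sum_div] at h
    linarith
  simp only [Fin.sum_univ_three, Complex.normSq_apply, Complex.add_re, Complex.add_im,
    Complex.sub_re, Complex.sub_im, Complex.mul_re, Complex.mul_im, Complex.I_re, Complex.I_im,
    Complex.star_def, Complex.conj_re, Complex.conj_im] at key ⊢
  linarith

/-- The unitary matrix `K` permutes the Pauli matrices cyclically, so the other off-diagonal moment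
entries follow from the first. -/
theorem IsMinimalTriple.rotate {v : Fin 3 → Fin 3 → ℂ} (hv : IsMinimalTriple v) :
    IsMinimalTriple fun i => ![v i 1, v i 2, v i 0] := by
  intro h
  let K : SL(2, ℂ) := slMk ((1 + Complex.I) / 2) ((1 + Complex.I) / 2) (-(1 - Complex.I) / 2)
    ((1 - Complex.I) / 2) (by linear_combination -Complex.I_mul_I / 2)
  have hK : ∀ i, K.1 * pauli (v i) * (K⁻¹).1 = pauli ![v i 1, v i 2, v i 0] := by
    intro i
    rw [Matrix.SpecialLinearGroup.coe_inv]
    change !![(1 + Complex.I) / 2, (1 + Complex.I) / 2; -(1 - Complex.I) / 2,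
      (1 - Complex.I) / 2] * pauli (v i) * (!![(1 + Complex.I) / 2, (1 + Complex.I) / 2;
        -(1 - Complex.I) / 2, (1 - Complex.I) / 2]).adjugate = _
    rw [Matrix.adjugate_fin_two_of]
    ext i j
    fin_cases i <;> fin_cases j <;> simp [pauli] <;> apply Complex.ext <;> simp <;> ring
  have h1 := hv (h * K)
  have h2 : ∀ i, (h * K).1 * pauli (v i) * ((h * K)⁻¹).1 =
      h.1 * pauli ![v i 1, v i 2, v i 0] * (h⁻¹).1 := by
    intro i
    rw [← hK, mul_inv_rev, Matrix.SpecialLinearGroup.coe_mul, Matrix.SpecialLinearGroup.coe_mul]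
    simp only [Matrix.mul_assoc]
  have h3 : ∀ i, nsq (pauli (v i)) = nsq (pauli ![v i 1, v i 2, v i 0]) := by
    intro i
    simp [nsq_pauli, Fin.sum_univ_three]
    ring
  simpa only [h2, h3] using h1

theorem IsMinimalTriple.sum_nsq_le {v : Fin 3 → Fin 3 → ℂ} (hv : IsMinimalTriple v) {β : ℝ}
    (hβ : ∀ i j, ‖∑ p, v i p * v j p‖ ≤ β) : ∑ i, nsq (pauli (v i)) ≤ 32 / 3 * β := by
  refine sum_nsq_le_of_moment_eq_zero (fun p q => ?_) hβ
  have h01 := hv.im_eq_zero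
  have h12 := hv.rotate.im_eq_zero
  have h20 := hv.rotate.rotate.im_eq_zero
  simp only [Fin.sum_univ_three, Complex.add_im, Complex.mul_im, Complex.star_def, Complex.conj_re,
    Complex.conj_im, Matrix.cons_val_zero, Matrix.cons_val_one, Matrix.cons_val] at h01 h12 h20 ⊢
  fin_cases p <;> fin_cases q <;> simp <;> linarith

/-- The identity and the Pauli matrices form an orthogonal basis with `nsq` equal to `2`, so the
left side is twice the squared Hilbert–Schmidt norm of `X ↦ h * X * h.adjugate`. -/
theorem sum_nsq_conj_pauli (h : Matrix (Fin 2) (Fin 2) ℂ) :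
    ∑ k : Fin 3, nsq (h * pauli (Pi.single k 1) * h.adjugate) + nsq (h * h.adjugate) =
      2 * nsq h ^ 2 := by
  rw [Matrix.adjugate_fin_two]
  simp [nsq, pauli, Fin.sum_univ_three, Complex.normSq_apply, Matrix.mul_apply]
  ring

/-- A spanning triple recovers the Pauli matrices with bounded coefficients, so the orbit norm `f`
controls `nsq h` from above. This coercivity reduces the minimisation to a compact set. -/
theorem exists_isMinimalTriple (w : Fin 3 → Fin 3 → ℂ) (hw : (Matrix.of w).det ≠ 0) :
    ∃ h : SL(2, ℂ), ∀ k : SL(2, ℂ), ∑ i, nsq (h.1 * pauli (w i) * (h⁻¹).1) ≤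
      ∑ i, nsq (k.1 * pauli (w i) * (k⁻¹).1) := by
  set f : Matrix (Fin 2) (Fin 2) ℂ → ℝ := fun h => ∑ i, nsq (h * pauli (w i) * h.adjugate) with hf
  have hfc : Continuous f := by
    have := Complex.continuous_normSq
    simp only [hf, nsq, Matrix.adjugate_fin_two]
    fun_prop
  have hfpos : ∀ h, 0 ≤ f h := fun h => Finset.sum_nonneg fun _ _ => nsq_nonneg _
  set W := Matrix.of w
  have hWi : W⁻¹ * W = 1 := Matrix.nonsing_inv_mul _ (isUnit_iff_ne_zero.2 hw)
  have hsingle : ∀ k : Fin 3, (Pi.single k 1 : Fin 3 → ℂ) = ∑ i, W⁻¹ k i • w i := by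
    intro k
    ext p
    have := congrFun (congrFun hWi k) p
    rw [Matrix.mul_apply] at this
    simp only [Finset.sum_apply, Pi.smul_apply, smul_eq_mul]
    rw [Matrix.one_apply] at this
    rw [Pi.single_apply]
    simp only [eq_comm (a := p)]
    exact this.symm
  obtain ⟨c, hc0, hc⟩ : ∃ c : ℝ, 0 ≤ c ∧ ∀ k i, Complex.normSq (W⁻¹ k i) ≤ c := by
    refine ⟨∑ k, ∑ i, Complex.normSq (W⁻¹ k i), Finset.sum_nonneg fun _ _ =>
      Finset.sum_nonneg fun _ _ => Complex.normSq_nonneg _, fun k i => ?_⟩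
    refine (Finset.single_le_sum (f := fun i => Complex.normSq (W⁻¹ k i))
      (fun _ _ => Complex.normSq_nonneg _) (Finset.mem_univ i)).trans
      (Finset.single_le_sum (f := fun k => ∑ i, Complex.normSq (W⁻¹ k i))
      (fun _ _ => Finset.sum_nonneg fun _ _ => Complex.normSq_nonneg _) (Finset.mem_univ k))
  have hcoer : ∀ h : SL(2, ℂ), 2 * nsq h.1 ^ 2 ≤ 9 * c * f h.1 + 2 := by
    intro h
    have h1 := sum_nsq_conj_pauli h.1
    have h2 : nsq (h.1 * h.1.adjugate) = 2 := by
      rw [Matrix.mul_adjugate, h.2, one_smul]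
      norm_num [nsq]
    have h3 : ∀ k : Fin 3, nsq (h.1 * pauli (Pi.single k 1) * h.1.adjugate) ≤ 3 * c * f h.1 := by
      intro k
      rw [hsingle, pauli_sum, Finset.mul_sum, Finset.sum_mul]
      simp only [Matrix.mul_smul, Matrix.smul_mul]
      refine (nsq_sum_smul_le _ _).trans ?_
      rw [mul_assoc, hf, Finset.mul_sum (a := c)]
      gcongr
      · exact nsq_nonneg _
      · exact hc _ _
    have h4 : ∑ k : Fin 3, nsq (h.1 * pauli (Pi.single k 1) * h.1.adjugate) ≤
        ∑ k : Fin 3, 3 * c * f h.1 := Finset.sum_le_sum fun k _ => h3 k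
    simp only [Finset.sum_const, Finset.card_univ, Fintype.card_fin, nsmul_eq_mul] at h4
    push_cast at h4
    linarith
  -- Wherever `nsq` exceeds this threshold, coercivity forces `f` to be at least `f 1`.
  set b := 9 * c * f 1 + 2 with hb
  have hb2 : 2 ≤ b := by
    have := mul_nonneg hc0 (hfpos 1)
    nlinarith
  have hne : ({M : Matrix (Fin 2) (Fin 2) ℂ | M.det = 1 ∧ nsq M ≤ b}).Nonempty :=
    ⟨1, Matrix.det_one, by norm_num [nsq]; linarith⟩
  obtain ⟨M, ⟨hM1, hMb⟩, hmin⟩ := (isCompact_nsq_le b).exists_isMinOn hne hfc.continuousOn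
  let h₀ : SL(2, ℂ) := ⟨M, hM1⟩
  refine ⟨h₀, fun k => ?_⟩
  rw [Matrix.SpecialLinearGroup.coe_inv h₀, Matrix.SpecialLinearGroup.coe_inv k]
  change f M ≤ f k.1
  by_cases hk : nsq k.1 ≤ b
  · exact hmin ⟨k.2, hk⟩
  · refine (hmin (a := 1) ⟨Matrix.det_one, by norm_num [nsq]; linarith⟩).trans ?_
    by_contra hlt
    push Not at hk hlt
    have h1 := hcoer k
    have h2 : 9 * c * f k.1 + 2 ≤ b := by
      have := mul_le_mul_of_nonneg_left hlt.le hc0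
      linarith
    nlinarith

/-- The trace form is invariant under conjugation, so the Gram bound `β` survives the passage to the
minimal triple. -/
theorem exists_conj_nsq_triple_le (w : Fin 3 → Fin 3 → ℂ) (hw : (Matrix.of w).det ≠ 0) {β : ℝ}
    (hβ : ∀ i j, ‖∑ p, w i p * w j p‖ ≤ β) :
    ∃ h : SL(2, ℂ), ∑ i, nsq (h.1 * pauli (w i) * (h⁻¹).1) ≤ 32 / 3 * β := by
  obtain ⟨h, hmin⟩ := exists_isMinimalTriple w hw
  have hh : (h⁻¹).1 * h.1 = 1 := by
    rw [← Matrix.SpecialLinearGroup.coe_mul, inv_mul_cancel, Matrix.SpecialLinearGroup.coe_one]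
  have hv : ∀ i, ∃ v, h.1 * pauli (w i) * (h⁻¹).1 = pauli v := by
    intro i
    apply exists_eq_pauli
    rw [Matrix.trace_mul_comm, ← Matrix.mul_assoc, hh, one_mul]
    simp [pauli, Matrix.trace_fin_two]
  choose v hv using hv
  have hvmin : IsMinimalTriple v := by
    intro k
    have := hmin (k * h)
    simp only [mul_inv_rev, Matrix.SpecialLinearGroup.coe_mul] at this
    simp only [← hv]
    simpa only [Matrix.mul_assoc] using this
  have hB : ∀ i j, ∑ p, v i p * v j p = ∑ p, w i p * w j p := by
    intro i j
    have h1 := trace_pauli_mul_pauli (v i) (v j)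
    rw [← hv, ← hv] at h1
    have h2 : h.1 * pauli (w i) * (h⁻¹).1 * (h.1 * pauli (w j) * (h⁻¹).1) =
        h.1 * (pauli (w i) * pauli (w j)) * (h⁻¹).1 := by
      calc _ = h.1 * pauli (w i) * ((h⁻¹).1 * h.1) * pauli (w j) * (h⁻¹).1 := by
            simp only [Matrix.mul_assoc]
        _ = _ := by rw [hh, mul_one]; simp only [Matrix.mul_assoc]
    rw [h2, Matrix.trace_mul_comm, ← Matrix.mul_assoc, hh, one_mul, trace_pauli_mul_pauli] at h1
    exact (mul_left_cancel₀ two_ne_zero h1).symm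
  refine ⟨h, ?_⟩
  simp only [hv]
  exact hvmin.sum_nsq_le fun i j => by rw [hB]; exact hβ i j

/-- Take a triple whose determinant has maximal modulus. By Cramer's rule each coefficient is a
quotient of the determinant of another triple by the maximal one. -/
theorem exists_triple_bounded_coeff {ι : Type*} [Finite ι] (u : ι → Fin 3 → ℂ)
    (hu : ∃ τ : Fin 3 → ι, (Matrix.of fun i => u (τ i)).det ≠ 0) :
    ∃ τ : Fin 3 → ι, (Matrix.of fun i => u (τ i)).det ≠ 0 ∧
      ∀ l, ∃ c : Fin 3 → ℂ, (∀ i, ‖c i‖ ≤ 1) ∧ u l = ∑ i, c i • u (τ i) := by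
  obtain ⟨τ₀, hτ₀⟩ := hu
  have : Nonempty (Fin 3 → ι) := ⟨τ₀⟩
  obtain ⟨τ, hτ⟩ := Finite.exists_max fun τ : Fin 3 → ι => ‖(Matrix.of fun i => u (τ i)).det‖
  have hne : (Matrix.of fun i => u (τ i)).det ≠ 0 :=
    norm_pos_iff.1 ((norm_pos_iff.2 hτ₀).trans_le (hτ τ₀))
  refine ⟨τ, hne, fun l => ?_⟩
  set W := Matrix.of fun i => u (τ i) with hW
  refine ⟨fun i => Matrix.cramer Wᵀ (u l) i / W.det, fun i => ?_, ?_⟩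
  · rw [norm_div, div_le_one (norm_pos_iff.2 hne), Matrix.cramer_transpose_apply]
    have e : W.updateRow i (u l) = Matrix.of fun a => u (Function.update τ i l a) := by
      ext a b
      by_cases h : a = i
      · subst h; simp
      · simp [h, hW]
    rw [e]
    exact hτ _
  · have h := Matrix.mulVec_cramer Wᵀ (u l)
    rw [Matrix.det_transpose] at h
    ext p
    have hp := congrFun h p
    simp only [Matrix.mulVec, dotProduct, Matrix.transpose_apply, Pi.smul_apply, smul_eq_mul] at hp
    simp only [Finset.sum_apply, Pi.smul_apply, smul_eq_mul]
    rw [← mul_right_inj' hne, ← hp, Finset.mul_sum]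
    refine Finset.sum_congr rfl fun i _ => ?_
    rw [show W i p = u (τ i) p from rfl]
    field_simp

theorem exists_conj_nsq_pauli_le {ι : Type*} [Finite ι] (u : ι → Fin 3 → ℂ) {β : ℝ} (hβ0 : 0 < β)
    (hβ : ∀ i j, ‖∑ p, u i p * u j p‖ ≤ β) :
    ∃ h : SL(2, ℂ), ∀ i, nsq (h.1 * pauli (u i) * (h⁻¹).1) ≤ 32 * β := by
  obtain ⟨B, hB⟩ : ∃ B : ℝ, ∀ i p, ‖u i p‖ ≤ B := by
    obtain ⟨B, hB⟩ := (Set.finite_range fun x : ι × Fin 3 => ‖u x.1 x.2‖).bddAbove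
    exact ⟨B, fun i p => hB ⟨(i, p), rfl⟩⟩
  -- The family need not span `ℂ³`. Adding the small multiples `ε` of the standard basis makes it
  -- span, and these two inequalities keep all Gram entries below `β`.
  obtain ⟨ε, hε, hε1, hε2⟩ : ∃ ε : ℝ, 0 < ε ∧ ε * B ≤ β ∧ ε * ε ≤ β := by
    have hden : 0 < 1 + |B| + β := by positivity
    have hb : β / (1 + |B| + β) * (1 + |B| + β) = β := div_mul_cancel₀ _ hden.ne'
    have hpos : 0 < β / (1 + |B| + β) := by positivity
    refine ⟨β / (1 + |B| + β), hpos, ?_, ?_⟩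
    · nlinarith [le_abs_self B, mul_le_mul_of_nonneg_left (le_abs_self B) hpos.le]
    · have h1 : β / (1 + |B| + β) ≤ 1 := by
        rw [div_le_one hden]
        linarith [abs_nonneg B]
      have h2 : β / (1 + |B| + β) ≤ β := by
        apply div_le_self hβ0.le
        linarith [abs_nonneg B]
      nlinarith
  set u' : ι ⊕ Fin 3 → Fin 3 → ℂ := Sum.elim u fun k => Pi.single k (ε : ℂ) with hu'
  have hβ' : ∀ i j, ‖∑ p, u' i p * u' j p‖ ≤ β := by
    have hεn : ‖(ε : ℂ)‖ = ε := by rw [Complex.norm_real, Real.norm_of_nonneg hε.le]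
    rintro (i | i) (j | j)
    · exact hβ i j
    · simp only [hu', Sum.elim_inl, Sum.elim_inr, Pi.single_apply, mul_ite, mul_zero,
        Finset.sum_ite_eq', Finset.mem_univ, if_true, norm_mul, hεn]
      nlinarith [hB i j]
    · simp only [hu', Sum.elim_inl, Sum.elim_inr, Pi.single_apply, ite_mul, zero_mul,
        Finset.sum_ite_eq', Finset.mem_univ, if_true, norm_mul, hεn]
      nlinarith [hB j i]
    · simp only [hu', Sum.elim_inr, Pi.single_apply, ite_mul, zero_mul, mul_ite, mul_zero,
        Finset.sum_ite_eq', Finset.mem_univ, if_true]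
      split_ifs
      · rw [norm_mul, hεn]; exact hε2
      · simpa using hβ0.le
  obtain ⟨τ, hdet, hτ⟩ := exists_triple_bounded_coeff u' ⟨Sum.inr, by
    have : (Matrix.of fun i : Fin 3 => u' (Sum.inr i)) = Matrix.diagonal fun _ => (ε : ℂ) := by
      ext a b
      simp [hu', Matrix.diagonal_apply, Pi.single_apply, eq_comm]
    rw [this, Matrix.det_diagonal]
    simpa using hε.ne'⟩
  obtain ⟨h, hh⟩ := exists_conj_nsq_triple_le (fun i => u' (τ i)) hdet fun i j => hβ' _ _
  refine ⟨h, fun i => ?_⟩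
  obtain ⟨c, hc, hi⟩ := hτ (Sum.inl i)
  have hi' : u i = ∑ i, c i • u' (τ i) := hi
  rw [hi', pauli_sum, Finset.mul_sum, Finset.sum_mul]
  simp only [Matrix.mul_smul, Matrix.smul_mul]
  refine (nsq_sum_smul_le _ _).trans ?_
  have : ∑ i, Complex.normSq (c i) * nsq (h.1 * pauli (u' (τ i)) * (h⁻¹).1) ≤
      ∑ i, nsq (h.1 * pauli (u' (τ i)) * (h⁻¹).1) := by
    refine Finset.sum_le_sum fun i _ => mul_le_of_le_one_left (nsq_nonneg _) ?_
    rw [Complex.normSq_eq_norm_sq]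
    exact pow_le_one₀ (norm_nonneg _) (hc i)
  linarith

/-- A finite family in `SL₂(ℂ)` whose members have traces of size at most `2r`, and whose pairwise
products have traces of size at most `2r²`, can be conjugated simultaneously to matrices of norm `O(r)`. -/
theorem exists_conj_nsq_le {ι : Type*} [Finite ι] (A : ι → SL(2, ℂ)) {r : ℝ} (hr : 0 < r)
    (h1 : ∀ i, ‖(A i).1.trace‖ ≤ 2 * r) (h2 : ∀ i j, ‖(A i * A j).1.trace‖ ≤ 2 * r ^ 2) :
    ∃ h : SL(2, ℂ), ∀ i, nsq (h * A i * h⁻¹).1 ≤ 132 * r ^ 2 := by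
  -- The scalar part is unaffected by conjugation; only the traceless part has to be made small.
  have hv : ∀ i, ∃ v, (A i).1 - ((A i).1.trace / 2) • (1 : Matrix (Fin 2) (Fin 2) ℂ) = pauli v :=
    fun i => exists_eq_pauli (by
      rw [Matrix.trace_sub, Matrix.trace_smul, Matrix.trace_one]
      simp)
  choose v hv using hv
  have hA : ∀ i, (A i).1 = ((A i).1.trace / 2) • (1 : Matrix (Fin 2) (Fin 2) ℂ) + pauli (v i) :=
    fun i => by rw [← hv]; simp
  have hB : ∀ i j, ∑ p, v i p * v j p =
      (A i * A j).1.trace / 2 - (A i).1.trace / 2 * ((A j).1.trace / 2) := by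
    intro i j
    have h := trace_pauli_mul_pauli (v i) (v j)
    rw [← hv, ← hv] at h
    rw [Matrix.SpecialLinearGroup.coe_mul]
    simp only [Matrix.sub_mul, Matrix.mul_sub, Matrix.smul_mul, Matrix.mul_smul, one_mul, mul_one,
      Matrix.trace_sub, Matrix.trace_smul, Matrix.trace_one, Fintype.card_fin, smul_eq_mul] at h
    push_cast at h
    linear_combination -h / 2
  obtain ⟨h, hh⟩ := exists_conj_nsq_pauli_le v (β := 2 * r ^ 2) (by positivity) fun i j => by
    rw [hB]
    refine (norm_sub_le _ _).trans ?_
    rw [norm_mul, norm_div, norm_div, norm_div, Complex.norm_ofNat]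
    have := mul_le_mul (h1 i) (h1 j) (norm_nonneg _) (by positivity)
    have := h2 i j
    linarith
  refine ⟨h, fun i => ?_⟩
  have e : (h * A i * h⁻¹).1 =
      ((A i).1.trace / 2) • (1 : Matrix (Fin 2) (Fin 2) ℂ) + h.1 * pauli (v i) * (h⁻¹).1 := by
    rw [Matrix.SpecialLinearGroup.coe_mul, Matrix.SpecialLinearGroup.coe_mul]
    have hh' : h.1 * (h⁻¹).1 = 1 := by
      rw [← Matrix.SpecialLinearGroup.coe_mul, mul_inv_cancel, Matrix.SpecialLinearGroup.coe_one]
    calc h.1 * (A i).1 * (h⁻¹).1 = h.1 * (((A i).1.trace / 2) • (1 : Matrix (Fin 2) (Fin 2) ℂ) +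
          pauli (v i)) * (h⁻¹).1 := by rw [← hA]
      _ = _ := by rw [Matrix.mul_add, Matrix.add_mul, Matrix.mul_smul, Matrix.smul_mul, mul_one, hh']
  rw [e]
  refine (nsq_add_le _ _).trans ?_
  have h3 : nsq (((A i).1.trace / 2) • (1 : Matrix (Fin 2) (Fin 2) ℂ)) ≤ 2 * r ^ 2 := by
    have h4 : ‖(A i).1.trace / 2‖ ≤ r := by
      rw [norm_div, Complex.norm_ofNat]
      linarith [h1 i]
    have h5 := pow_le_pow_left₀ (norm_nonneg _) h4 2
    simp only [nsq, Matrix.smul_apply, Matrix.one_apply, smul_eq_mul, Complex.normSq_eq_norm_sq]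
    simp only [Fin.isValue, ↓reduceIte, mul_one, zero_ne_one, mul_zero, norm_zero, one_ne_zero]
    linarith
  linarith [hh i]

/-! ### Surface groups are torsion-free -/

/-- In the hyperboloid model `cosh (dist w z)` is linear in `z`, and a sum of future timelike
vectors is `C` times a point `c`. The point `c` is a centre of mass. -/
theorem UpperHalfPlane.exists_sum_cosh_dist_eq {ι : Type*} [Fintype ι] [Nonempty ι]
    (z : ι → UpperHalfPlane) : ∃ (c : UpperHalfPlane) (C : ℝ), 0 < C ∧
      ∀ w, ∑ k, Real.cosh (dist w (z k)) = C * Real.cosh (dist w c) := by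
  have him : ∀ k, 0 < (z k).im := fun k => (z k).im_pos
  set a := ∑ k, 1 / (z k).im with ha
  have ha0 : 0 < a := Finset.sum_pos (fun k _ => by have := him k; positivity) Finset.univ_nonempty
  set b := ∑ k, (z k).re / (z k).im with hb
  set d := ∑ k, ((z k).re ^ 2 + (z k).im ^ 2) / (z k).im with hd
  set p := b / a with hp
  have hpa : p * a = b := div_mul_cancel₀ _ ha0.ne'
  clear_value p
  have hsum : ∀ x : ℝ, ∑ k, ((x - (z k).re) ^ 2 + (z k).im ^ 2) / (z k).im =
      a * x ^ 2 - 2 * b * x + d := by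
    intro x
    rw [ha, hb, hd, Finset.sum_mul, Finset.mul_sum, Finset.sum_mul, ← Finset.sum_sub_distrib,
      ← Finset.sum_add_distrib]
    refine Finset.sum_congr rfl fun k _ => ?_
    have := (him k).ne'
    field_simp
    ring
  have hm0 : 0 < a * p ^ 2 - 2 * b * p + d := by
    rw [← hsum]
    exact Finset.sum_pos (fun k _ => by have := him k; positivity) Finset.univ_nonempty
  set m := a * p ^ 2 - 2 * b * p + d with hm
  have hq : 0 < √(m / a) := Real.sqrt_pos.2 (by positivity)
  have hq2 : a * √(m / a) ^ 2 = m := by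
    rw [Real.sq_sqrt (by positivity)]; field_simp
  set q := √(m / a)
  refine ⟨⟨⟨p, q⟩, hq⟩, a * q, by positivity, fun w => ?_⟩
  have hw := w.im_pos
  have h1 : ∀ k, Real.cosh (dist w (z k)) = (((w.re - (z k).re) ^ 2 + (z k).im ^ 2) / (z k).im +
      w.im ^ 2 * (1 / (z k).im)) / (2 * w.im) := by
    intro k
    have := (him k).ne'
    rw [UpperHalfPlane.cosh_dist']
    field_simp
    ring
  simp_rw [h1]
  rw [← Finset.sum_div, Finset.sum_add_distrib, hsum, ← Finset.mul_sum, ← ha,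
    UpperHalfPlane.cosh_dist']
  change _ = a * q * (((w.re - p) ^ 2 + w.im ^ 2 + q ^ 2) / (2 * w.im * q))
  field_simp
  linear_combination -hq2 + 2 * (w.re - p) * hpa

/-- The centre of mass of an orbit of the finite cyclic group is fixed by `g`, against freeness. -/
theorem IsHyperbolicSurfaceGroup.eq_one_of_isOfFinOrder {Γ : Type*} [Group Γ]
    (hΓ : IsHyperbolicSurfaceGroup Γ) {g : Γ} (hg : IsOfFinOrder g) : g = 1 := by
  obtain ⟨φ, hfree, -, -⟩ := hΓ
  by_contra hne
  have : Finite (Subgroup.zpowers g) := (finite_zpowers.2 hg).to_subtype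
  have := Fintype.ofFinite (Subgroup.zpowers g)
  let w₀ : UpperHalfPlane := UpperHalfPlane.I
  obtain ⟨c, C, hC, hc⟩ := UpperHalfPlane.exists_sum_cosh_dist_eq
    fun h : Subgroup.zpowers g => φ h w₀
  have hinv : ∑ h : Subgroup.zpowers g, Real.cosh (dist (φ g c) (φ h w₀)) =
      ∑ h : Subgroup.zpowers g, Real.cosh (dist c (φ h w₀)) := by
    rw [← Equiv.sum_comp (Equiv.mulLeft (⟨g, Subgroup.mem_zpowers g⟩ : Subgroup.zpowers g))]
    refine Finset.sum_congr rfl fun h _ => ?_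
    simp only [Equiv.coe_mulLeft, Subgroup.coe_mul, map_mul]
    congr 1
    exact (φ g).isometry.dist_eq _ _
  rw [hc, hc, dist_self, Real.cosh_zero] at hinv
  have h1 : Real.cosh (dist (φ g c) c) = 1 := mul_left_cancel₀ hC.ne' hinv
  have h2 : dist (φ g c) c = 0 := by
    by_contra h
    exact absurd h1 (Real.one_lt_cosh.2 h).ne'
  exact hfree g hne c (dist_eq_zero.1 h2)

/-! ### Lengths and proper discontinuity for representations -/

namespace PSLRep

variable {Γ : Type*} [Group Γ]

/-- `A ∈ SL₂(ℂ)` represents `ρ g ∈ PSL₂(ℂ)`. -/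
def IsLift (ρ : Γ →* PSL(2, ℂ)) (g : Γ) (A : SL(2, ℂ)) : Prop :=
  QuotientGroup.mk' (Subgroup.center SL(2, ℂ)) A = ρ g

theorem exists_isLift (ρ : Γ →* PSL(2, ℂ)) (g : Γ) : ∃ A, IsLift ρ g A :=
  QuotientGroup.mk'_surjective _ (ρ g)

variable {ρ : Γ →* PSL(2, ℂ)} {g h : Γ} {A B : SL(2, ℂ)}

theorem IsLift.mul (hA : IsLift ρ g A) (hB : IsLift ρ h B) : IsLift ρ (g * h) (A * B) := by
  unfold IsLift at *
  rw [map_mul, map_mul, hA, hB]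

theorem IsLift.inv (hA : IsLift ρ g A) : IsLift ρ g⁻¹ A⁻¹ := by
  unfold IsLift at *
  rw [map_inv, map_inv, hA]

theorem IsLift.pow (hA : IsLift ρ g A) (k : ℕ) : IsLift ρ (g ^ k) (A ^ k) := by
  unfold IsLift at *
  rw [map_pow, map_pow, hA]

theorem IsLift.act_eq (hA : IsLift ρ g A) (X : Hyp3) : act ρ g X = A • X := by
  unfold act
  rw [← hA]
  rfl

theorem act_one (X : Hyp3) : act ρ 1 X = X := by simp [act]

theorem act_mul (g h : Γ) (X : Hyp3) : act ρ (g * h) X = act ρ g (act ρ h X) := by simp [act]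

theorem hdist_act (g : Γ) (X Y : Hyp3) :
    Hyp3.hdist (act ρ g X) (act ρ g Y) = Hyp3.hdist X Y := by
  obtain ⟨A, hA⟩ := exists_isLift ρ g
  rw [hA.act_eq, hA.act_eq, Hyp3.hdist_smul]

theorem IsLift.length_eq (hA : IsLift ρ g A) : length ρ g = stableLength A := by
  refine Tendsto.limUnder_eq ((tendsto_stableLength A).congr fun k => ?_)
  rw [(hA.pow k).act_eq, disp]

theorem length_nonneg (ρ : Γ →* PSL(2, ℂ)) (g : Γ) : 0 ≤ length ρ g := by
  obtain ⟨A, hA⟩ := exists_isLift ρ g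
  rw [hA.length_eq]
  exact stableLength_nonneg A

theorem length_le_hdist (ρ : Γ →* PSL(2, ℂ)) (g : Γ) (X : Hyp3) :
    length ρ g ≤ Hyp3.hdist X (act ρ g X) := by
  obtain ⟨A, hA⟩ := exists_isLift ρ g
  rw [hA.length_eq, hA.act_eq]
  exact stableLength_le_hdist A X

theorem length_pow (ρ : Γ →* PSL(2, ℂ)) (g : Γ) (m : ℕ) :
    length ρ (g ^ m) = m * length ρ g := by
  obtain ⟨A, hA⟩ := exists_isLift ρ g
  rw [hA.length_eq, (hA.pow m).length_eq, stableLength_pow]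

theorem length_conj (ρ : Γ →* PSL(2, ℂ)) (g h : Γ) :
    length ρ (h * g * h⁻¹) = length ρ g := by
  obtain ⟨A, hA⟩ := exists_isLift ρ g
  obtain ⟨B, hB⟩ := exists_isLift ρ h
  rw [hA.length_eq, ((hB.mul hA).mul hB.inv).length_eq, stableLength_conj]

theorem length_eq_zero_of_isOfFinOrder (ρ : Γ →* PSL(2, ℂ)) (hg : IsOfFinOrder g) :
    length ρ g = 0 := by
  obtain ⟨n, hn, hgn⟩ := isOfFinOrder_iff_pow_eq_one.1 hg
  have h0 := length_pow ρ (1 : Γ) 0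
  have h := length_pow ρ g n
  rw [one_pow, Nat.cast_zero, zero_mul] at h0
  rw [hgn, h0] at h
  have hn' : (n : ℝ) ≠ 0 := by exact_mod_cast hn.ne'
  simpa [hn'] using h.symm

theorem hdist_act_pow_le (ρ : Γ →* PSL(2, ℂ)) (g : Γ) (X : Hyp3) (j : ℕ) :
    Hyp3.hdist X (act ρ (g ^ j) X) ≤ j * Hyp3.hdist X (act ρ g X) := by
  induction j with
  | zero => simp [act_one, Hyp3.hdist_self]
  | succ j ih =>
    rw [pow_succ, act_mul]
    have h1 := Hyp3.hdist_triangle X (act ρ (g ^ j) X) (act ρ (g ^ j) (act ρ g X))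
    rw [hdist_act] at h1
    push_cast
    linarith

theorem ConvexCocompact.finite_hdist_le (hρ : ConvexCocompact ρ) (X : Hyp3) (R : ℝ) :
    {f : Γ | Hyp3.hdist X (act ρ f X) ≤ R}.Finite := by
  set r := Hyp3.hdist Hyp3.origin X
  -- The maximum with `0` keeps the origin itself in the ball.
  set R' := max 0 (R + 2 * r)
  refine (hρ.1 _ (Hyp3.isCompact_closedBall_origin R')).subset fun f hf => ?_
  refine ⟨act ρ f Hyp3.origin, ⟨Hyp3.origin, ?_, rfl⟩, ?_⟩
  · exact (Hyp3.hdist_self _).trans_le (le_max_left _ _)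
  · refine le_trans (b := R + 2 * r) ?_ (le_max_right _ _)
    have h1 := Hyp3.hdist_triangle Hyp3.origin X (act ρ f Hyp3.origin)
    have h2 := Hyp3.hdist_triangle X (act ρ f X) (act ρ f Hyp3.origin)
    rw [hdist_act, Hyp3.hdist_comm X Hyp3.origin] at h2
    have : Hyp3.hdist X (act ρ f X) ≤ R := hf
    linarith

theorem ConvexCocompact.isOfFinOrder_of_fixed (hρ : ConvexCocompact ρ) {X : Hyp3}
    (hX : act ρ g X = X) : IsOfFinOrder g := by
  by_contra hg
  refine (Set.infinite_range_of_injective (injective_pow_iff_not_isOfFinOrder.2 hg)).mono ?_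
    (hρ.finite_hdist_le X 0)
  rintro _ ⟨j, rfl⟩
  have := hdist_act_pow_le ρ g X j
  rw [hX, Hyp3.hdist_self, mul_zero] at this
  exact this

theorem hdist_act_conj_le (ρ : Γ →* PSL(2, ℂ)) (k g : Γ) (X Y : Hyp3) :
    Hyp3.hdist X (act ρ (k * g * k⁻¹) X) ≤
      2 * Hyp3.hdist (act ρ k Y) X + Hyp3.hdist Y (act ρ g Y) := by
  have h1 := Hyp3.hdist_triangle X (act ρ k Y) (act ρ (k * g * k⁻¹) X)
  have h2 := Hyp3.hdist_triangle (act ρ k Y) (act ρ (k * g * k⁻¹) (act ρ k Y))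
    (act ρ (k * g * k⁻¹) X)
  have h3 : act ρ (k * g * k⁻¹) (act ρ k Y) = act ρ k (act ρ g Y) := by
    rw [← act_mul, ← act_mul]
    congr 1
    group
  rw [hdist_act, h3, hdist_act] at h2
  rw [Hyp3.hdist_comm X (act ρ k Y)] at h1
  linarith

/-- If `g` moves `Y` by at most `1 / N`, its first `N` powers move `Y` by at most `1`. Carrying `Y`
near a fixed `x` makes their conjugates move `x` by at most `2 * D + 1`; only `N - 1` elements do
so, hence two powers coincide. -/
theorem ConvexCocompact.isOfFinOrder_of_small_displacement (hρ : ConvexCocompact ρ) {D : ℝ}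
    (hD : HullCobounded ρ D)
    (hg : ∀ δ : ℝ, 0 < δ → ∃ Y ∈ hull ρ, Hyp3.hdist Y (act ρ g Y) ≤ δ) : IsOfFinOrder g := by
  by_contra hfin
  obtain ⟨x, hx⟩ := hρ.2.1
  have hF := hρ.finite_hdist_le x (2 * D + 1)
  set N := hF.toFinset.card + 1
  have hN : (0 : ℝ) < N := by positivity
  obtain ⟨Y, hY, hYδ⟩ := hg (1 / N) (by positivity)
  obtain ⟨k, hk⟩ := hD Y hY x hx
  have hmaps : ∀ j ∈ Finset.range N, k * g ^ j * k⁻¹ ∈ hF.toFinset := by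
    intro j hj
    have hj' : (j : ℝ) ≤ N := by exact_mod_cast (Finset.mem_range.1 hj).le
    rw [Set.Finite.mem_toFinset]
    refine (hdist_act_conj_le ρ k (g ^ j) x Y).trans ?_
    have h1 := hdist_act_pow_le ρ g Y j
    have h2 : (j : ℝ) * Hyp3.hdist Y (act ρ g Y) ≤ N * (1 / N) :=
      mul_le_mul hj' hYδ (Hyp3.hdist_nonneg _ _) hN.le
    rw [mul_one_div_cancel hN.ne'] at h2
    linarith
  obtain ⟨i, -, j, -, hij, h⟩ := Finset.exists_ne_map_eq_of_card_lt_of_maps_to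
    (by rw [Finset.card_range]; exact Nat.lt_succ_self _) hmaps
  exact hij (injective_pow_iff_not_isOfFinOrder.2 hfin (mul_left_cancel (mul_right_cancel h)))

end PSLRep

/-! ### Geodesic rays to ideal points -/

theorem trace_mul_conjTranspose (M : Matrix (Fin 2) (Fin 2) ℂ) : (M * Mᴴ).trace = (nsq M : ℂ) := by
  simp only [nsq, Matrix.trace_fin_two, Matrix.mul_apply, Fin.sum_univ_two,
    Matrix.conjTranspose_apply, Complex.star_def, Complex.mul_conj]
  push_cast
  ring

theorem nsq_pos {M : Matrix (Fin 2) (Fin 2) ℂ} (hM : M ≠ 0) : 0 < nsq M := by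
  refine lt_of_le_of_ne (nsq_nonneg M) fun h => hM ?_
  have h0 := Complex.normSq_nonneg
  unfold nsq at h
  have e : ∀ x, Complex.normSq x ≤ 0 → x = 0 := fun x hx =>
    Complex.normSq_eq_zero.1 (le_antisymm hx (h0 x))
  have := h0 (M 0 0)
  have := h0 (M 0 1)
  have := h0 (M 1 0)
  have := h0 (M 1 1)
  rw [Matrix.eta_fin_two M, e (M 0 0) (by linarith), e (M 0 1) (by linarith),
    e (M 1 0) (by linarith), e (M 1 1) (by linarith)]
  exact (Matrix.eta_fin_two 0).symm

open scoped MatrixOrder Matrix.Norms.L2Operator in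
theorem Matrix.PosSemidef.exists_eq_mul_conjTranspose {P : Matrix (Fin 2) (Fin 2) ℂ}
    (hP : P.PosSemidef) : ∃ C : Matrix (Fin 2) (Fin 2) ℂ, P = C * Cᴴ := by
  obtain ⟨C, rfl⟩ := CStarAlgebra.nonneg_iff_eq_star_mul_self.mp hP.nonneg
  exact ⟨Cᴴ, by rw [Matrix.conjTranspose_conjTranspose]; rfl⟩

namespace Hyp3

theorem inv_eq_adjugate (X : Hyp3) : X.1⁻¹ = X.1.adjugate := by
  rw [Matrix.inv_def, X.2.2, Ring.inverse_one, one_smul]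

theorem trace_pos (X : Hyp3) : ∃ t : ℝ, 0 < t ∧ X.1.trace = t := by
  obtain ⟨A, rfl⟩ := exists_smul_origin X
  exact ⟨nsq A.1, by linarith [two_le_nsq A], by rw [coe_smul_origin, trace_mul_conjTranspose]⟩

theorem klein_trace (X : Hyp3) : X.klein.trace = 1 := by
  obtain ⟨t, ht, hX⟩ := trace_pos X
  rw [klein, Matrix.trace_smul, hX, smul_eq_mul, inv_mul_cancel₀]
  exact_mod_cast ht.ne'

theorem coe_eq_smul_klein (X : Hyp3) : ∃ t : ℝ, 0 < t ∧ X.1 = t • X.klein := by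
  obtain ⟨t, ht, hX⟩ := trace_pos X
  refine ⟨t, ht, ?_⟩
  have : (t : ℂ) ≠ 0 := by exact_mod_cast ht.ne'
  rw [klein, hX, ← Complex.coe_smul, smul_smul, mul_inv_cancel₀ this, one_smul]

/-- The ray from `X` towards `P` is `X + s • P` rescaled to determinant one. As `P` is null, `det (X
+ s • P)` is affine in `s` with slope `q`. -/
theorem exists_ray (X : Hyp3) {P : Matrix (Fin 2) (Fin 2) ℂ} (hP : P ∈ idealBoundary) :
    ∃ q : ℝ, 0 < q ∧ (X.1⁻¹ * P).trace = q ∧ ∀ s : ℝ, 0 ≤ s → ∃ Z : Hyp3,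
      Z.1 = (√(1 + s * q))⁻¹ • (X.1 + s • P) := by
  obtain ⟨hpsd, htr, hdet⟩ := hP
  obtain ⟨q, hq, hqt⟩ : ∃ q : ℝ, 0 < q ∧ (X.1⁻¹ * P).trace = q := by
    obtain ⟨B, rfl⟩ := exists_smul_origin X
    obtain ⟨C, hC⟩ := hpsd.exists_eq_mul_conjTranspose
    have hB : IsUnit B.1.det := by rw [B.2]; exact isUnit_one
    have hne : B.1⁻¹ * C ≠ 0 := by
      intro h
      have : C = 0 := by
        rw [← one_mul C, ← Matrix.mul_nonsing_inv _ hB, Matrix.mul_assoc, h, Matrix.mul_zero]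
      rw [hC, this] at htr
      simp at htr
    refine ⟨nsq (B.1⁻¹ * C), nsq_pos hne, ?_⟩
    rw [coe_smul_origin, Matrix.mul_inv_rev, hC, ← trace_mul_conjTranspose,
      Matrix.conjTranspose_mul, Matrix.conjTranspose_nonsing_inv, Matrix.mul_assoc,
      Matrix.trace_mul_comm]
    simp only [Matrix.mul_assoc]
  refine ⟨q, hq, hqt, fun s hs => ?_⟩
  have h1 : 0 < 1 + s * q := by positivity
  have hr : 0 < (√(1 + s * q))⁻¹ := by positivity
  refine ⟨⟨(√(1 + s * q))⁻¹ • (X.1 + s • P), ?_, ?_⟩, rfl⟩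
  · exact (X.2.1.add_posSemidef (hpsd.smul hs)).smul hr
  · have hd : (X.1 + s • P).det = ((1 + s * q : ℝ) : ℂ) := by
      have hX := X.2.2
      rw [inv_eq_adjugate, Matrix.adjugate_fin_two] at hqt
      simp only [Matrix.trace_fin_two, Matrix.mul_apply, Fin.sum_univ_two, Matrix.of_apply,
        Matrix.cons_val', Matrix.cons_val_zero, Matrix.cons_val_one,
        Matrix.cons_val_fin_one] at hqt
      rw [Matrix.det_fin_two] at hdet hX ⊢
      simp
      linear_combination hX + s ^ 2 * hdet + s * hqt
    have hr2 : ((√(1 + s * q))⁻¹ : ℝ) ^ 2 * (1 + s * q) = 1 := by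
      rw [inv_pow, Real.sq_sqrt h1.le, inv_mul_cancel₀ h1.ne']
    rw [← Complex.coe_smul, Matrix.det_smul, hd, Fintype.card_fin]
    exact_mod_cast hr2

theorem hdist_ray (X Z : Hyp3) {P : Matrix (Fin 2) (Fin 2) ℂ} {q s : ℝ} (hq : 0 < q) (hs : 0 ≤ s)
    (hqt : (X.1⁻¹ * P).trace = q) (hZ : Z.1 = (√(1 + s * q))⁻¹ • (X.1 + s • P)) :
    hdist X Z = Real.log (1 + s * q) / 2 := by
  have h1 : 0 < 1 + s * q := by positivity
  have hX : X.1⁻¹ * X.1 = 1 :=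
    Matrix.nonsing_inv_mul _ (by rw [X.2.2]; exact isUnit_one)
  have hr : 0 < √(1 + s * q) := Real.sqrt_pos.2 h1
  have ht : (X.1⁻¹ * Z.1).trace.re / 2 = Real.cosh (Real.log (1 + s * q) / 2) := by
    rw [hZ, Matrix.mul_smul, Matrix.mul_add, Matrix.mul_smul, hX, Matrix.trace_smul,
      Matrix.trace_add, Matrix.trace_smul, hqt, Matrix.trace_one, ← Real.log_sqrt h1.le,
      Real.cosh_log hr]
    simp
    have hsq := Real.sq_sqrt h1.le
    field_simp
    linarith
  rw [hdist, ht, Real.arcosh_cosh]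
  have : 0 ≤ Real.log (1 + s * q) := Real.log_nonneg (by nlinarith)
  linarith

/-- If `A` fixes the null vector `P` itself, and not only its line, the displacement tends to `0`
along the ray towards `P`. -/
theorem hdist_ray_smul (X Z : Hyp3) (A : SL(2, ℂ)) {P : Matrix (Fin 2) (Fin 2) ℂ} {q s : ℝ}
    (hq : 0 < q) (hs : 0 ≤ s) (hdet : P.det = 0) (hA : A.1 * P * A.1ᴴ = P)
    (hqt : (X.1⁻¹ * P).trace = q) (hZ : Z.1 = (√(1 + s * q))⁻¹ • (X.1 + s • P)) :
    hdist Z (A • Z) =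
      Real.arcosh (((X.1⁻¹ * (A • X).1).trace.re / 2 + s * q) / (1 + s * q)) := by
  have h1 : 0 < 1 + s * q := by positivity
  have hqt' : ((A • X).1⁻¹ * P).trace = q := by
    have hAu : IsUnit A.1.det := by rw [A.2]; exact isUnit_one
    have hAu' : IsUnit (A.1ᴴ).det := by rw [Matrix.det_conjTranspose, A.2]; simp
    rw [← hqt, coe_smul, Matrix.mul_inv_rev, Matrix.mul_inv_rev]
    nth_rewrite 1 [← hA]
    calc ((A.1ᴴ)⁻¹ * (X.1⁻¹ * A.1⁻¹) * (A.1 * P * A.1ᴴ)).trace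
        = ((A.1ᴴ)⁻¹ * (X.1⁻¹ * (A.1⁻¹ * A.1) * P * A.1ᴴ)).trace := by simp only [Matrix.mul_assoc]
      _ = (X.1⁻¹ * P).trace := by
        rw [Matrix.nonsing_inv_mul _ hAu, mul_one, Matrix.trace_mul_comm, Matrix.mul_assoc,
          Matrix.mul_nonsing_inv _ hAu', mul_one]
  have hAZ : (A • Z).1 = (√(1 + s * q))⁻¹ • ((A • X).1 + s • P) := by
    rw [coe_smul, hZ, Matrix.mul_smul, Matrix.smul_mul, Matrix.mul_add, Matrix.add_mul,
      Matrix.mul_smul, Matrix.smul_mul, hA, ← coe_smul]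
  unfold hdist
  congr 1
  have hr2 : (((√(1 + s * q))⁻¹ : ℝ) : ℂ) ^ 2 = ((1 + s * q : ℝ) : ℂ)⁻¹ := by
    rw [← Complex.ofReal_pow, inv_pow, Real.sq_sqrt h1.le, Complex.ofReal_inv]
  have key : (Z.1⁻¹ * (A • Z).1).trace = (((√(1 + s * q))⁻¹ : ℝ) : ℂ) ^ 2 *
      ((X.1⁻¹ * (A • X).1).trace + 2 * s * q) := by
    rw [inv_eq_adjugate] at hqt hqt' ⊢
    rw [inv_eq_adjugate, hZ, hAZ]
    rw [Matrix.det_fin_two] at hdet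
    rw [Matrix.adjugate_fin_two] at hqt hqt' ⊢
    rw [Matrix.adjugate_fin_two]
    simp only [Matrix.trace_fin_two, Matrix.mul_apply, Fin.sum_univ_two, Matrix.of_apply,
      Matrix.cons_val', Matrix.cons_val_zero, Matrix.cons_val_one, Matrix.cons_val_fin_one,
      Matrix.smul_apply, Matrix.add_apply, Complex.real_smul] at hqt hqt' ⊢
    linear_combination (((√(1 + s * q))⁻¹ : ℝ) : ℂ) ^ 2 * (2 * s ^ 2 * hdet + s * hqt + s * hqt')
  rw [key, hr2, ← Complex.ofReal_inv, Complex.re_ofReal_mul]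
  simp only [Complex.add_re]
  rw [show (2 * (s : ℂ) * q).re = 2 * s * q by norm_cast]
  field_simp

end Hyp3

/-! ### Limit points of powers, parabolics and axes -/

theorem slTri_zero_pow_val (μ : ℂ) (hμ : μ ≠ 0) (k : ℕ) :
    ((slTri μ 0 hμ) ^ k).1 = !![μ ^ k, 0; 0, (μ⁻¹) ^ k] := by
  induction k with
  | zero => simp [Matrix.one_fin_two]
  | succ k ih =>
    rw [pow_succ, Matrix.SpecialLinearGroup.coe_mul]
    change ((slTri μ 0 hμ) ^ k).1 * (slTri μ 0 hμ).1 = _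
    rw [ih, slTri_val]
    simp [pow_succ]

theorem slTri_parabolic_pow_val (μ b : ℂ) (hμ : μ ≠ 0) (h1 : μ ^ 2 = 1) (k : ℕ) :
    ((slTri μ b hμ) ^ k).1 = μ ^ k • !![1, k * (μ * b); 0, 1] := by
  have hinv : μ⁻¹ = μ := inv_eq_of_mul_eq_one_right (by rw [← pow_two, h1])
  induction k with
  | zero => simp [Matrix.one_fin_two]
  | succ k ih =>
    rw [pow_succ, Matrix.SpecialLinearGroup.coe_mul]
    change ((slTri μ b hμ) ^ k).1 * (slTri μ b hμ).1 = _
    rw [ih, slTri_val, hinv]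
    ext i j
    fin_cases i <;> fin_cases j <;> simp [pow_succ]
    linear_combination (-(μ ^ k * b)) * h1

theorem conj_pow_val (h T : SL(2, ℂ)) (k : ℕ) :
    ((h * T * h⁻¹) ^ k).1 = h.1 * (T ^ k).1 * (h⁻¹).1 := by
  rw [conj_pow, Matrix.SpecialLinearGroup.coe_mul, Matrix.SpecialLinearGroup.coe_mul]

theorem inv_val_mul_val (h : SL(2, ℂ)) : (h⁻¹).1 * h.1 = 1 := by
  rw [← Matrix.SpecialLinearGroup.coe_mul, inv_mul_cancel, Matrix.SpecialLinearGroup.coe_one]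

theorem conj_val_ne_zero (h : SL(2, ℂ)) {J : Matrix (Fin 2) (Fin 2) ℂ} (hJ : J ≠ 0) :
    h.1 * J * (h⁻¹).1 ≠ 0 := by
  intro h0
  apply hJ
  calc J = ((h⁻¹).1 * h.1) * J * ((h⁻¹).1 * h.1) := by
        rw [inv_val_mul_val, one_mul, mul_one]
    _ = (h⁻¹).1 * (h.1 * J * (h⁻¹).1) * h.1 := by simp only [Matrix.mul_assoc]
    _ = 0 := by rw [h0]; simp

theorem det_conj_val (h : SL(2, ℂ)) (J : Matrix (Fin 2) (Fin 2) ℂ) :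
    (h.1 * J * (h⁻¹).1).det = J.det := by
  rw [Matrix.det_mul, Matrix.det_mul, h.2, (h⁻¹).2]
  simp

theorem corner_mul_mul_conjTranspose (N : Matrix (Fin 2) (Fin 2) ℂ) :
    !![1, 0; 0, 0] * N * (!![1, 0; 0, 0] * N)ᴴ =
      ((Complex.normSq (N 0 0) + Complex.normSq (N 0 1) : ℝ) : ℂ) • !![1, 0; 0, 0] := by
  have h : !![1, 0; 0, 0] * N = !![N 0 0, N 0 1; 0, 0] := by
    conv_lhs => rw [Matrix.eta_fin_two N, Matrix.mul_fin_two]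
    simp only [one_mul, zero_mul, add_zero]
  rw [h]
  ext i j
  fin_cases i <;> fin_cases j <;> simp [Matrix.mul_apply, Complex.mul_conj]

namespace PSLRep

variable {Γ : Type*} [Group Γ] {ρ : Γ →* PSL(2, ℂ)} {g : Γ} {A : SL(2, ℂ)}

/-- The Klein point of `A ^ k` applied to the origin is the trace normalisation of `A ^ k * (A ^
k)ᴴ`, which ignores the scalars `s k` and so converges to that of `F * Fᴴ`. -/
theorem IsLift.mem_limitSet (hA : IsLift ρ g A) {s : ℕ → ℂ} {F : Matrix (Fin 2) (Fin 2) ℂ}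
    (hs : ∀ k, s k ≠ 0) (hF0 : F ≠ 0) (hdet : F.det = 0)
    (hF : Tendsto (fun k => s k • (A ^ k).1) atTop (𝓝 F)) :
    (nsq F : ℂ)⁻¹ • (F * Fᴴ) ∈ limitSet ρ := by
  have hn : (nsq F : ℂ) ≠ 0 := by exact_mod_cast (nsq_pos hF0).ne'
  constructor
  · refine ⟨?_, ?_, ?_⟩
    · refine (Matrix.posSemidef_self_mul_conjTranspose F).smul ?_
      rw [← Complex.ofReal_inv, Complex.zero_le_real]
      exact inv_nonneg.2 (nsq_nonneg F)
    · rw [Matrix.trace_smul, trace_mul_conjTranspose, smul_eq_mul, inv_mul_cancel₀ hn]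
    · rw [Matrix.det_smul, Matrix.det_mul, hdet]
      simp
  · have hlim : Tendsto (fun k => ((s k • (A ^ k).1) * (s k • (A ^ k).1)ᴴ).trace⁻¹ •
        ((s k • (A ^ k).1) * (s k • (A ^ k).1)ᴴ)) atTop (𝓝 ((F * Fᴴ).trace⁻¹ • (F * Fᴴ))) := by
      have hmul : Tendsto (fun k => (s k • (A ^ k).1) * (s k • (A ^ k).1)ᴴ) atTop
          (𝓝 (F * Fᴴ)) := by
        have hc : Continuous fun M : Matrix (Fin 2) (Fin 2) ℂ => M * Mᴴ := by fun_prop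
        exact (hc.tendsto F).comp hF
      have htr : Tendsto (fun k => ((s k • (A ^ k).1) * (s k • (A ^ k).1)ᴴ).trace) atTop
          (𝓝 (F * Fᴴ).trace) := by
        have hc : Continuous fun M : Matrix (Fin 2) (Fin 2) ℂ => M.trace := by fun_prop
        exact (hc.tendsto _).comp hmul
      exact (htr.inv₀ (by rwa [trace_mul_conjTranspose])).smul hmul
    rw [trace_mul_conjTranspose] at hlim
    refine mem_closure_of_tendsto hlim (Eventually.of_forall fun k => ⟨g ^ k, ?_⟩)
    simp only
    rw [(hA.pow k).act_eq, Hyp3.klein, Hyp3.coe_smul_origin]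
    have hsk : s k * star (s k) ≠ 0 := mul_ne_zero (hs k) (star_ne_zero.2 (hs k))
    simp only [Matrix.conjTranspose_smul, Matrix.smul_mul, Matrix.mul_smul, Matrix.trace_smul,
      smul_smul, smul_eq_mul]
    congr 1
    have : ((A ^ k).1 * (A ^ k).1ᴴ).trace ≠ 0 := by
      rw [trace_mul_conjTranspose]
      exact_mod_cast (by linarith [two_le_nsq (A ^ k)] : nsq (A ^ k).1 ≠ 0)
    have h2 := hs k
    have h3 := star_ne_zero.2 h2
    field_simp

theorem limitSet_trace {P : Matrix (Fin 2) (Fin 2) ℂ} (hP : P ∈ limitSet ρ) : P.trace = 1 := hP.1.2.1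

theorem mem_hull_of_eq_add {X : Hyp3} {P Q : Matrix (Fin 2) (Fin 2) ℂ} {a b : ℝ} (ha : 0 ≤ a)
    (hb : 0 ≤ b) (hP : P ∈ convexHull ℝ (limitSet ρ)) (hQ : Q ∈ convexHull ℝ (limitSet ρ))
    (hPt : P.trace = 1) (hQt : Q.trace = 1) (hX : X.1 = a • P + b • Q) : X ∈ hull ρ := by
  have htr : X.1.trace = ((a + b : ℝ) : ℂ) := by
    rw [hX, Matrix.trace_add, Matrix.trace_smul, Matrix.trace_smul, hPt, hQt]
    simp
  obtain ⟨t, ht, hXt⟩ := Hyp3.trace_pos X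
  have hab : a + b = t := by
    rw [hXt] at htr
    exact_mod_cast htr.symm
  have hk : X.klein = (a / t) • P + (b / t) • Q := by
    rw [Hyp3.klein, hXt, hX, ← Complex.ofReal_inv, Complex.coe_smul, smul_add, smul_smul, smul_smul]
    congr 2 <;> ring
  change X.klein ∈ convexHull ℝ (limitSet ρ)
  rw [hk]
  refine (convex_convexHull ℝ (limitSet ρ)) hP hQ (by positivity) (by positivity) ?_
  rw [← add_div, hab, div_self ht.ne']

theorem mem_hull_ray {X Z : Hyp3} (hX : X ∈ hull ρ) {P : Matrix (Fin 2) (Fin 2) ℂ}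
    (hP : P ∈ limitSet ρ) {r s : ℝ} (hr : 0 ≤ r) (hs : 0 ≤ s) (hZ : Z.1 = r • (X.1 + s • P)) :
    Z ∈ hull ρ := by
  obtain ⟨t, ht, hXt⟩ := Hyp3.coe_eq_smul_klein X
  refine mem_hull_of_eq_add (a := r * t) (b := r * s) (by positivity) (by positivity) hX
    (subset_convexHull ℝ _ hP) X.klein_trace (limitSet_trace hP) ?_
  rw [hZ, smul_add, smul_smul]
  nth_rewrite 1 [hXt]
  rw [smul_smul]

/-- The fixed point of a parabolic is a limit point, so a ray towards it stays in the hull, and the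
displacement along it becomes arbitrarily small. -/
theorem ConvexCocompact.isOfFinOrder_of_parabolic (hρ : ConvexCocompact ρ) {D : ℝ}
    (hD : HullCobounded ρ D) {h : SL(2, ℂ)} {μ b : ℂ} (hμ : μ ≠ 0) (h1 : μ ^ 2 = 1) (hb : b ≠ 0)
    (hA : IsLift ρ g (h * slTri μ b hμ * h⁻¹)) : IsOfFinOrder g := by
  set A := h * slTri μ b hμ * h⁻¹ with hAdef
  set J : Matrix (Fin 2) (Fin 2) ℂ := !![0, μ * b; 0, 0] with hJ
  set F := h.1 * J * (h⁻¹).1 with hF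
  have hJ0 : J ≠ 0 := by
    intro h0
    have := congrFun (congrFun h0 0) 1
    simp [hJ, hμ, hb] at this
  have hF0 : F ≠ 0 := conj_val_ne_zero h hJ0
  have hFd : F.det = 0 := by
    rw [hF, det_conj_val, hJ]
    simp
  have hμμ : ∀ k : ℕ, μ ^ k * μ ^ k = 1 := by
    intro k
    rw [← pow_add, ← two_mul, pow_mul, h1, one_pow]
  have hlim : Tendsto (fun k : ℕ => (μ ^ k / (k + 1 : ℂ)) • (A ^ k).1) atTop (𝓝 F) := by
    have e : ∀ k : ℕ, (μ ^ k / (k + 1 : ℂ)) • (A ^ k).1 =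
        h.1 * ((1 / ((k : ℂ) + 1)) • (1 - J) + J) * (h⁻¹).1 := by
      intro k
      have hk : (k : ℂ) + 1 ≠ 0 := by exact_mod_cast Nat.succ_ne_zero k
      rw [hAdef, conj_pow_val, ← Matrix.smul_mul, ← Matrix.mul_smul,
        slTri_parabolic_pow_val μ b hμ h1]
      congr 2
      rw [smul_smul, div_mul_eq_mul_div, hμμ]
      ext i j
      fin_cases i <;> fin_cases j <;> simp [hJ]
      field_simp
      ring
    simp_rw [e]
    have hc : Continuous fun M : Matrix (Fin 2) (Fin 2) ℂ => h.1 * M * (h⁻¹).1 := by fun_prop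
    refine (hc.tendsto J).comp ?_
    have := ((tendsto_one_div_add_atTop_nhds_zero_nat (𝕜 := ℂ)).smul_const (1 - J)).add_const J
    simpa using this
  have hP := hA.mem_limitSet (s := fun k : ℕ => μ ^ k / (k + 1 : ℂ)) (fun k =>
    div_ne_zero (pow_ne_zero _ hμ) (by exact_mod_cast Nat.succ_ne_zero k)) hF0 hFd hlim
  set P := (nsq F : ℂ)⁻¹ • (F * Fᴴ) with hPdef
  have hAF : A.1 * F = μ • F := by
    have : A.1 = h.1 * (slTri μ b hμ).1 * (h⁻¹).1 := by
      rw [hAdef, Matrix.SpecialLinearGroup.coe_mul, Matrix.SpecialLinearGroup.coe_mul]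
    calc A.1 * F = h.1 * (slTri μ b hμ).1 * ((h⁻¹).1 * h.1) * J * (h⁻¹).1 := by
          rw [this, hF]; simp only [Matrix.mul_assoc]
      _ = h.1 * ((slTri μ b hμ).1 * J) * (h⁻¹).1 := by
          rw [inv_val_mul_val, mul_one]; simp only [Matrix.mul_assoc]
      _ = μ • F := by
          rw [hF, ← Matrix.smul_mul, ← Matrix.mul_smul]
          congr 2
          rw [slTri_val, hJ]
          ext i j
          fin_cases i <;> fin_cases j <;> simp
  have hμn : μ * star μ = 1 := by
    rcases sq_eq_one_iff.1 h1 with h | h <;> simp [h]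
  have hAP : A.1 * P * A.1ᴴ = P := by
    rw [hPdef, Matrix.mul_smul, Matrix.smul_mul]
    congr 1
    calc A.1 * (F * Fᴴ) * A.1ᴴ = (A.1 * F) * (A.1 * F)ᴴ := by
          rw [Matrix.conjTranspose_mul A.1 F]; simp only [Matrix.mul_assoc]
      _ = F * Fᴴ := by
          rw [hAF, Matrix.conjTranspose_smul, Matrix.smul_mul, Matrix.mul_smul, smul_smul, hμn,
            one_smul]
  obtain ⟨X, hX⟩ := hρ.2.1
  obtain ⟨q, hq, hqt, hray⟩ := X.exists_ray hP.1
  refine hρ.isOfFinOrder_of_small_displacement hD fun δ hδ => ?_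
  set c := (X.1⁻¹ * (A • X).1).trace.re / 2 with hc
  have hδ1 : 0 < Real.cosh δ - 1 := by linarith [Real.one_lt_cosh.2 hδ.ne']
  -- This parameter gives `s * q * (cosh δ - 1) = |c|`, enough for `(c + s * q) / (1 + s * q) ≤ cosh
  -- δ`.
  obtain ⟨Z, hZ⟩ := hray (|c| / (q * (Real.cosh δ - 1))) (by positivity)
  set s := |c| / (q * (Real.cosh δ - 1)) with hs
  have hs0 : 0 ≤ s := by positivity
  refine ⟨Z, mem_hull_ray hX hP (by positivity) hs0 hZ, ?_⟩
  rw [hA.act_eq, Hyp3.hdist_ray_smul X Z A hq hs0 hP.1.2.2 hAP hqt hZ, ← hc]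
  have hsq : s * q * (Real.cosh δ - 1) = |c| := by rw [hs]; field_simp
  have hden : 0 < 1 + s * q := by positivity
  have hle : (c + s * q) / (1 + s * q) ≤ Real.cosh δ := by
    rw [div_le_iff₀ hden]
    nlinarith [le_abs_self c]
  rw [← Real.arcosh_cosh hδ.le]
  have hc1 : 1 ≤ c := Hyp3.one_le_trace_inv_mul X (A • X)
  rw [Real.arcosh_le_arcosh (by positivity) (Real.cosh_pos _)]
  exact hle

theorem ConvexCocompact.exists_conj_slTri_zero (hρ : ConvexCocompact ρ) {D : ℝ}
    (hD : HullCobounded ρ D) (hg : ¬ IsOfFinOrder g) (hA : IsLift ρ g A) :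
    ∃ (h : SL(2, ℂ)) (μ : ℂ) (hμ : μ ≠ 0), 1 < ‖μ‖ ∧ A = h * slTri μ 0 hμ * h⁻¹ := by
  rcases exists_conj_slTri_zero_or_parabolic A with ⟨h, μ, hμ, rfl⟩ | ⟨h, μ, b, hμ, h1, hb, rfl⟩
  · rcases lt_trichotomy ‖μ‖ 1 with hlt | heq | hgt
    -- The Weyl element exchanges the two eigenvalues.
    · let w : SL(2, ℂ) := slMk 0 (-1) 1 0 (by simp)
      have hw : slTri μ 0 hμ = w * slTri μ⁻¹ 0 (inv_ne_zero hμ) * w⁻¹ := by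
        rw [eq_mul_inv_iff_mul_eq]
        apply Subtype.ext
        change !![μ, 0; 0, μ⁻¹] * !![0, -1; 1, 0] = !![0, -1; 1, 0] * !![μ⁻¹, 0; 0, μ⁻¹⁻¹]
        ext i j
        fin_cases i <;> fin_cases j <;> simp
      refine ⟨h * w, μ⁻¹, inv_ne_zero hμ, ?_, ?_⟩
      · rw [norm_inv]
        exact (one_lt_inv₀ (norm_pos_iff.2 hμ)).2 hlt
      · rw [hw]
        group
    -- The elliptic case: `h • origin` is a fixed point.
    · exfalso
      apply hg
      apply hρ.isOfFinOrder_of_fixed (X := h • Hyp3.origin)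
      rw [hA.act_eq, mul_smul, inv_smul_smul, mul_smul]
      congr 1
      apply Subtype.ext
      rw [Hyp3.coe_smul_origin, slTri_val]
      have h1 : μ * star μ = 1 := by
        rw [Complex.star_def, Complex.mul_conj, Complex.normSq_eq_norm_sq, heq]
        simp
      have h2 : μ⁻¹ * star μ⁻¹ = 1 := by
        rw [star_inv₀, ← mul_inv, h1, inv_one]
      rw [Complex.star_def] at h1 h2
      change _ = (1 : Matrix (Fin 2) (Fin 2) ℂ)
      rw [map_inv₀] at h2
      ext i j
      fin_cases i <;> fin_cases j <;> simp [Matrix.mul_apply, h1, h2]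
    · exact ⟨h, μ, hμ, hgt, rfl⟩
  · exact absurd (hρ.isOfFinOrder_of_parabolic hD hμ h1 hb hA) hg

theorem IsLift.mem_limitSet_of_conj_diag {h : SL(2, ℂ)} {μ : ℂ} (hμ : μ ≠ 0) (hμ1 : 1 < ‖μ‖)
    (hA : IsLift ρ g (h * slTri μ 0 hμ * h⁻¹)) :
    ∃ (P : Matrix (Fin 2) (Fin 2) ℂ) (a : ℝ), P ∈ limitSet ρ ∧ 0 < a ∧
      h.1 * !![1, 0; 0, 0] * h.1ᴴ = a • P := by
  set J : Matrix (Fin 2) (Fin 2) ℂ := !![1, 0; 0, 0] with hJ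
  set F := h.1 * J * (h⁻¹).1 with hF
  have hJ0 : J ≠ 0 := by
    intro h0
    have := congrFun (congrFun h0 0) 0
    simp [hJ] at this
  have hF0 : F ≠ 0 := conj_val_ne_zero h hJ0
  have hFd : F.det = 0 := by
    rw [hF, det_conj_val, hJ]
    simp
  have hlim : Tendsto (fun k : ℕ => (μ⁻¹ ^ k) • ((h * slTri μ 0 hμ * h⁻¹) ^ k).1) atTop (𝓝 F) := by
    have e : ∀ k : ℕ, (μ⁻¹ ^ k) • ((h * slTri μ 0 hμ * h⁻¹) ^ k).1 =
        h.1 * (((μ⁻¹ * μ⁻¹) ^ k) • (1 - J) + J) * (h⁻¹).1 := by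
      intro k
      rw [conj_pow_val, ← Matrix.smul_mul, ← Matrix.mul_smul, slTri_zero_pow_val]
      congr 2
      ext i j
      fin_cases i <;> fin_cases j <;> simp [hJ, mul_pow, hμ]
    simp_rw [e]
    have hc : Continuous fun M : Matrix (Fin 2) (Fin 2) ℂ => h.1 * M * (h⁻¹).1 := by fun_prop
    refine (hc.tendsto J).comp ?_
    have h1 : ‖μ⁻¹ * μ⁻¹‖ < 1 := by
      rw [norm_mul, norm_inv]
      have := inv_lt_one_of_one_lt₀ hμ1
      have h0 : 0 < ‖μ‖⁻¹ := by positivity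
      nlinarith
    have := ((tendsto_pow_atTop_nhds_zero_of_norm_lt_one h1).smul_const (1 - J)).add_const J
    simpa using this
  have hP := hA.mem_limitSet (s := fun k : ℕ => μ⁻¹ ^ k)
    (fun k => pow_ne_zero _ (inv_ne_zero hμ)) hF0 hFd hlim
  have hFF : F * Fᴴ = ((Complex.normSq ((h⁻¹).1 0 0) + Complex.normSq ((h⁻¹).1 0 1) : ℝ) : ℂ) •
      (h.1 * J * h.1ᴴ) := by
    have hJJ : J * (h⁻¹).1 * (J * (h⁻¹).1)ᴴ =
        ((Complex.normSq ((h⁻¹).1 0 0) + Complex.normSq ((h⁻¹).1 0 1) : ℝ) : ℂ) • J :=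
      corner_mul_mul_conjTranspose _
    calc F * Fᴴ = h.1 * (J * (h⁻¹).1 * (J * (h⁻¹).1)ᴴ) * h.1ᴴ := by
          rw [hF, Matrix.mul_assoc h.1 J, Matrix.conjTranspose_mul h.1]
          simp only [Matrix.mul_assoc]
      _ = _ := by rw [hJJ, Matrix.mul_smul, Matrix.smul_mul]
  set m := Complex.normSq ((h⁻¹).1 0 0) + Complex.normSq ((h⁻¹).1 0 1) with hm
  have hm0 : 0 < m := by
    refine lt_of_le_of_ne (add_nonneg (Complex.normSq_nonneg _) (Complex.normSq_nonneg _)) ?_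
    intro h0
    have h1 := trace_mul_conjTranspose F
    rw [hFF, ← h0, Complex.ofReal_zero, zero_smul, Matrix.trace_zero] at h1
    exact (nsq_pos hF0).ne (by exact_mod_cast h1)
  refine ⟨_, nsq F / m, hP, div_pos (nsq_pos hF0) hm0, ?_⟩
  have hn : (nsq F : ℂ) ≠ 0 := by exact_mod_cast (nsq_pos hF0).ne'
  have hmc : (m : ℂ) ≠ 0 := by exact_mod_cast hm0.ne'
  rw [hFF, ← Complex.coe_smul, smul_smul, smul_smul]
  push_cast
  rw [show (nsq F / m * (nsq F : ℂ)⁻¹ * m) = 1 by field_simp, one_smul]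

/-- The axis of a non-torsion element lies in the convex hull of the limit set. -/
theorem ConvexCocompact.exists_axis (hρ : ConvexCocompact ρ) {D : ℝ} (hD : HullCobounded ρ D)
    (hg : ¬ IsOfFinOrder g) : 0 < length ρ g ∧ ∃ Y : ℝ → Hyp3, (∀ t, Y t ∈ hull ρ) ∧
      (∀ s t, Hyp3.hdist (Y s) (Y t) = |t - s|) ∧
      ∀ t, act ρ g (Y t) = Y (t + length ρ g) := by
  obtain ⟨A, hA⟩ := exists_isLift ρ g
  obtain ⟨h, μ, hμ, hμ1, rfl⟩ := hρ.exists_conj_slTri_zero hD hg hA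
  have hlog : 0 < Real.log ‖μ‖ := Real.log_pos hμ1
  have hlen : length ρ g = 2 * Real.log ‖μ‖ := by
    rw [hA.length_eq, stableLength_conj, stableLength_slTri_zero, abs_of_pos hlog]
  refine ⟨by linarith, ?_⟩
  have hexp : ∀ t : ℝ, Complex.exp (t / 2 : ℝ) ≠ 0 := fun t => Complex.exp_ne_zero _
  have hdiag : ∀ (ν : ℂ) (hν : ν ≠ 0), (slTri ν 0 hν • Hyp3.origin).1 =
      !![((‖ν‖ ^ 2 : ℝ) : ℂ), 0; 0, (((‖ν‖ ^ 2)⁻¹ : ℝ) : ℂ)] := by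
    intro ν hν
    rw [Hyp3.coe_smul_origin, slTri_val]
    have e1 : ν * (starRingEnd ℂ) ν = ((‖ν‖ ^ 2 : ℝ) : ℂ) := by
      rw [Complex.mul_conj, Complex.normSq_eq_norm_sq]
    ext i j
    fin_cases i <;> fin_cases j
    · simp [Matrix.mul_apply, e1]
    · simp [Matrix.mul_apply]
    · simp [Matrix.mul_apply]
    · simp only [Complex.ofReal_inv, ← e1]
      simp [Matrix.mul_apply, mul_comm]
  have hdiag' : ∀ t : ℝ, (slTri (Complex.exp (t / 2 : ℝ)) 0 (hexp t) • Hyp3.origin).1 =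
      !![((Real.exp t : ℝ) : ℂ), 0; 0, ((Real.exp (-t) : ℝ) : ℂ)] := by
    intro t
    rw [hdiag, Complex.norm_exp_ofReal, ← Real.exp_nat_mul, Real.exp_neg]
    congr 5 <;> push_cast <;> ring_nf
  obtain ⟨P, a, hP, ha, hPa⟩ := hA.mem_limitSet_of_conj_diag hμ hμ1
  -- The repelling end is the attracting end of `g⁻¹`.
  obtain ⟨Q, b, hQ, hb, hQb⟩ : ∃ (Q : Matrix (Fin 2) (Fin 2) ℂ) (b : ℝ), Q ∈ limitSet ρ ∧ 0 < b ∧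
      h.1 * !![0, 0; 0, 1] * h.1ᴴ = b • Q := by
    let w : SL(2, ℂ) := slMk 0 (-1) 1 0 (by simp)
    have hinv : IsLift ρ g⁻¹ ((h * w) * slTri μ 0 hμ * (h * w)⁻¹) := by
      have hw : (slTri μ 0 hμ)⁻¹ = w * slTri μ 0 hμ * w⁻¹ := by
        rw [eq_mul_inv_iff_mul_eq, inv_mul_eq_iff_eq_mul]
        apply Subtype.ext
        change !![0, -1; 1, 0] = !![μ, 0; 0, μ⁻¹] * (!![0, -1; 1, 0] * !![μ, 0; 0, μ⁻¹])
        ext i j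
        fin_cases i <;> fin_cases j <;> simp [hμ]
      have := hA.inv
      rwa [show (h * slTri μ 0 hμ * h⁻¹)⁻¹ = h * (slTri μ 0 hμ)⁻¹ * h⁻¹ by group, hw,
        show h * (w * slTri μ 0 hμ * w⁻¹) * h⁻¹ = (h * w) * slTri μ 0 hμ * (h * w)⁻¹ by
          group] at this
    obtain ⟨Q, b, hQ, hb, hQb⟩ := hinv.mem_limitSet_of_conj_diag hμ hμ1
    refine ⟨Q, b, hQ, hb, ?_⟩
    rw [← hQb, Matrix.SpecialLinearGroup.coe_mul, Matrix.conjTranspose_mul]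
    have hw : !![0, 0; 0, 1] = w.1 * !![1, 0; 0, 0] * w.1ᴴ := by
      change _ = !![0, -1; 1, 0] * !![1, 0; 0, 0] * (!![0, -1; 1, 0])ᴴ
      ext i j
      fin_cases i <;> fin_cases j <;> simp [Matrix.mul_apply]
    rw [hw]
    simp only [Matrix.mul_assoc]
  -- The point at time `t` is `exp t * a • P + exp (-t) * b • Q`, on the Klein chord joining the two
  -- limit points.
  refine ⟨fun t => h • slTri (Complex.exp (t / 2 : ℝ)) 0 (hexp t) • Hyp3.origin, fun t => ?_,
    fun s t => ?_, fun t => ?_⟩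
  · refine mem_hull_of_eq_add (a := Real.exp t * a) (b := Real.exp (-t) * b) (by positivity)
      (by positivity) (subset_convexHull ℝ _ hP) (subset_convexHull ℝ _ hQ) (limitSet_trace hP)
      (limitSet_trace hQ) ?_
    rw [Hyp3.coe_smul, hdiag', mul_smul, mul_smul, ← hPa, ← hQb, ← Matrix.smul_mul,
      ← Matrix.mul_smul, ← Matrix.smul_mul, ← Matrix.mul_smul, ← Matrix.add_mul, ← Matrix.mul_add]
    congr 2
    ext i j
    fin_cases i <;> fin_cases j <;> simp
  · rw [Hyp3.hdist_smul]
    have h1 : ((slTri (Complex.exp (s / 2 : ℝ)) 0 (hexp s) • Hyp3.origin).1⁻¹ *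
        (slTri (Complex.exp (t / 2 : ℝ)) 0 (hexp t) • Hyp3.origin).1).trace.re / 2 =
        Real.cosh |t - s| := by
      rw [Hyp3.inv_eq_adjugate, hdiag', hdiag', Matrix.adjugate_fin_two_of, Real.cosh_abs,
        Real.cosh_eq, neg_sub, sub_eq_add_neg, sub_eq_add_neg, Real.exp_add, Real.exp_add]
      simp [Matrix.trace_fin_two]
      norm_cast
      ring
    rw [Hyp3.hdist, h1, Real.arcosh_cosh (abs_nonneg _)]
  · rw [hA.act_eq, mul_smul, inv_smul_smul, mul_smul]
    congr 1
    apply Subtype.ext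
    rw [Hyp3.coe_smul, hdiag', hdiag', slTri_val, hlen, neg_add, Real.exp_add, Real.exp_add,
      Real.exp_neg (2 * _), two_mul, Real.exp_add, Real.exp_log (norm_pos_iff.2 hμ)]
    have e1 : μ * (starRingEnd ℂ) μ = (‖μ‖ : ℂ) ^ 2 := Complex.mul_conj' μ
    have hc0 : (starRingEnd ℂ) μ ≠ 0 := by simpa using hμ
    ext i j
    fin_cases i <;> fin_cases j
    · simp [Matrix.mul_apply]
      linear_combination Complex.exp t * e1
    · simp [Matrix.mul_apply]
    · simp [Matrix.mul_apply]
    · simp [Matrix.mul_apply]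
      rw [← mul_inv, ← pow_two, ← e1]
      field_simp

end PSLRep

/-! ### Comparison of the two length functions -/

namespace PSLRep

variable {Γ : Type*} [Group Γ] {ρ : Γ →* PSL(2, ℂ)}

/-- A finite set of elements almost realizes, at a common point of `ℍ³`, half of the largest
translation length of the products of two of its members. -/
theorem exists_hdist_act_le (ρ : Γ →* PSL(2, ℂ)) {S : Set Γ} (hS : S.Finite) {m : ℝ}
    (hm : ∀ s ∈ S, ∀ t ∈ S, length ρ (s * t) ≤ m) :
    ∃ y : Hyp3, ∀ s ∈ S, Hyp3.hdist y (act ρ s y) ≤ m / 2 + Real.log 132 := by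
  have := hS.to_subtype
  choose A hA using fun s : S => exists_isLift ρ s.1
  have hr : Real.exp (m / 4) ^ 2 = Real.exp (m / 2) := by
    rw [← Real.exp_nat_mul]
    congr 1
    push_cast
    ring
  -- The bound for a single `s` comes from the product `s * s`, whose length is twice that of `s`;
  -- hence `r = exp (m / 4)`.
  obtain ⟨h, hh⟩ := exists_conj_nsq_le A (Real.exp_pos (m / 4)) (fun s => by
    refine (norm_trace_le _).trans
      (mul_le_mul_of_nonneg_left (Real.exp_le_exp.2 ?_) zero_le_two)
    have h1 := hm s.1 s.2 s.1 s.2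
    rw [← pow_two, length_pow, (hA s).length_eq] at h1
    push_cast at h1
    linarith) (fun s t => by
    refine (norm_trace_le _).trans ?_
    rw [hr]
    gcongr
    rw [← ((hA s).mul (hA t)).length_eq]
    exact hm s.1 s.2 t.1 t.2)
  refine ⟨h⁻¹ • Hyp3.origin, fun s hs => ?_⟩
  have h1 := disp_le_log_nsq (h * A ⟨s, hs⟩ * h⁻¹)
  have h2 := hh ⟨s, hs⟩
  rw [hr] at h2
  have h3 : Real.log (nsq (h * A ⟨s, hs⟩ * h⁻¹).1) ≤ Real.log (132 * Real.exp (m / 2)) :=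
    Real.log_le_log (by linarith [two_le_nsq (h * A ⟨s, hs⟩ * h⁻¹)]) h2
  rw [Real.log_mul (by norm_num) (Real.exp_pos _).ne', Real.log_exp] at h3
  have h4 : Hyp3.hdist (h⁻¹ • Hyp3.origin) (act ρ s (h⁻¹ • Hyp3.origin)) =
      disp (h * A ⟨s, hs⟩ * h⁻¹) := by
    rw [(hA ⟨s, hs⟩).act_eq, ← Hyp3.hdist_smul h, smul_inv_smul, disp, mul_smul, mul_smul]
  linarith

/-- Each short class has a representative whose axis passes within `D` of a fixed hull point `x`, so
it moves `x` by at most `2 * D + L`; only finitely many elements do. -/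
theorem ConvexCocompact.finite_ratios (hρ : ConvexCocompact ρ) {D : ℝ} (hD : HullCobounded ρ D)
    (ρs : Γ →* PSL(2, ℂ)) (L : ℝ) :
    {r : ℝ | ∃ g : Γ, 0 < length ρ g ∧ length ρ g ≤ L ∧ r = length ρs g / length ρ g}.Finite := by
  obtain ⟨x, hx⟩ := hρ.2.1
  refine ((hρ.finite_hdist_le x (2 * D + L)).image fun g => length ρs g / length ρ g).subset ?_
  rintro _ ⟨g, hg0, hgL, rfl⟩
  have hg : ¬ IsOfFinOrder g := fun h => hg0.ne' (length_eq_zero_of_isOfFinOrder ρ h)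
  obtain ⟨-, Y, hY, hYd, hYg⟩ := hρ.exists_axis hD hg
  obtain ⟨k, hk⟩ := hD (Y 0) (hY 0) x hx
  refine ⟨k * g * k⁻¹, ?_, by simp only [length_conj]⟩
  refine (hdist_act_conj_le ρ k g x (Y 0)).trans ?_
  rw [hYg, hYd, sub_zero, zero_add, abs_of_pos hg0]
  linarith

/-- Take a hull point `Z` at distance `L - D` from `X` and an orbit point of `X` within `D` of `Z`.
As `L - D > D`, the element is not the identity, and it moves `X` by at most `L`. -/
theorem ConvexCocompact.exists_length_le (hΓ : IsHyperbolicSurfaceGroup Γ)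
    (hρ : ConvexCocompact ρ) {D L : ℝ} (hD : HullCobounded ρ D) (hD0 : 0 ≤ D) (hL : 2 * D < L) :
    ∃ g : Γ, ¬ IsOfFinOrder g ∧ 0 < length ρ g ∧ length ρ g ≤ L := by
  obtain ⟨X, hX⟩ := hρ.2.1
  obtain ⟨P, hP⟩ : (limitSet ρ).Nonempty := convexHull_nonempty_iff.1 ⟨_, hX⟩
  obtain ⟨q, hq, hqt, hray⟩ := X.exists_ray hP.1
  have hLD : 0 ≤ L - D := by linarith
  set s := (Real.exp (2 * (L - D)) - 1) / q with hs
  have hs0 : 0 ≤ s := div_nonneg (by linarith [Real.one_le_exp (by linarith : 0 ≤ 2 * (L - D))]) hq.le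
  have hsq : 1 + s * q = Real.exp (2 * (L - D)) := by
    rw [hs, div_mul_cancel₀ _ hq.ne']
    ring
  obtain ⟨Z, hZ⟩ := hray s hs0
  have hXZ : Hyp3.hdist X Z = L - D := by
    rw [Hyp3.hdist_ray X Z hq hs0 hqt hZ, hsq, Real.log_exp]
    ring
  obtain ⟨g, hg⟩ := hD X hX Z (mem_hull_ray hX hP (by positivity) hs0 hZ)
  have hgf : ¬ IsOfFinOrder g := by
    intro hfin
    rw [hΓ.eq_one_of_isOfFinOrder hfin, act_one] at hg
    linarith
  refine ⟨g, hgf, (hρ.exists_axis hD hgf).1, (length_le_hdist ρ g X).trans ?_⟩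
  have h1 := Hyp3.hdist_triangle X Z (act ρ g X)
  rw [Hyp3.hdist_comm Z] at h1
  linarith

theorem ConvexCocompact.length_le_of_short_ratio_le (hρ : ConvexCocompact ρ)
    (ρs : Γ →* PSL(2, ℂ)) {D L M : ℝ} (hD : HullCobounded ρ D) (hD0 : 0 ≤ D) (hL : 4 * D < L)
    (hM0 : 0 ≤ M)
    (hM : ∀ g : Γ, 0 < length ρ g → length ρ g ≤ L → length ρs g / length ρ g ≤ M)
    {g : Γ} (hg : ¬ IsOfFinOrder g) :
    length ρs g ≤ 2 * length ρ g / (L - 4 * D) * (M * L / 2 + Real.log 132) := by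
  obtain ⟨hpos, Y, hY, hYd, hYg⟩ := hρ.exists_axis hD hg
  set T := length ρ g
  set x := Y 0 with hx
  have hYpow : ∀ m : ℕ, act ρ (g ^ m) x = Y (m * T) := by
    intro m
    induction m with
    | zero => simp [act_one, hx]
    | succ m ih =>
      rw [pow_succ', act_mul, ih, hYg]
      congr 1
      push_cast
      ring
  set S : Set Γ := {s | Hyp3.hdist x (act ρ s x) ≤ L / 2} with hS
  have hL0 : 0 < L := by linarith
  obtain ⟨y, hy⟩ := exists_hdist_act_le ρs (hρ.finite_hdist_le x (L / 2)) (m := M * L)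
    (fun s hs t ht => by
      have hst : length ρ (s * t) ≤ L := by
        refine (length_le_hdist ρ (s * t) x).trans ?_
        have h1 := Hyp3.hdist_triangle x (act ρ s x) (act ρ s (act ρ t x))
        rw [hdist_act] at h1
        rw [act_mul]
        have h2 : Hyp3.hdist x (act ρ s x) ≤ L / 2 := hs
        have h3 : Hyp3.hdist x (act ρ t x) ≤ L / 2 := ht
        linarith
      -- A torsion product has `ρ`-length zero and is not covered by `hM`; its `ρs`-length is zero
      -- as well.
      by_cases hfin : IsOfFinOrder (s * t)
      · rw [length_eq_zero_of_isOfFinOrder ρs hfin]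
        positivity
      · have h0 := (hρ.exists_axis hD hfin).1
        have := hM _ h0 hst
        rw [div_le_iff₀ h0] at this
        exact this.trans (mul_le_mul_of_nonneg_left hst hM0))
  set E := M * L / 2 + Real.log 132 with hE
  have hE0 : 0 ≤ E := by
    have : 0 ≤ Real.log 132 := Real.log_nonneg (by norm_num)
    positivity
  have hw : 0 < L - 4 * D := by linarith
  have hbound : ∀ m : ℕ, 0 < m → m * length ρs g ≤ (2 * (m * T) / (L - 4 * D) + 1) * E := by
    intro m hm
    have hm' : (0 : ℝ) < m := by exact_mod_cast hm
    -- With this many pieces each has length `d ≤ (L - 4 * D) / 2`, so two errors of `D` still leave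
    -- `d + 2 * D ≤ L / 2`.
    set n := ⌈2 * (m * T) / (L - 4 * D)⌉₊ with hn
    have hn0 : 0 < n := Nat.ceil_pos.2 (by positivity)
    have hn0' : (0 : ℝ) < n := by exact_mod_cast hn0
    have hnle : 2 * (m * T) / (L - 4 * D) ≤ n := Nat.le_ceil _
    have hnlt : (n : ℝ) < 2 * (m * T) / (L - 4 * D) + 1 := Nat.ceil_lt_add_one (by positivity)
    set d := m * T / n with hd
    have hd0 : 0 < d := by positivity
    have hdle : d ≤ (L - 4 * D) / 2 := by
      rw [div_le_iff₀ hw] at hnle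
      rw [hd, div_le_iff₀ hn0']
      linarith
    -- Both ends are prescribed exactly, so that the steps multiply to `g ^ m`.
    have hk : ∀ i : ℕ, ∃ k : Γ, Hyp3.hdist (act ρ k x) (Y (i * d)) ≤ D ∧ (i = 0 → k = 1) ∧
        (i = n → k = g ^ m) := by
      intro i
      by_cases h0 : i = 0
      · subst h0
        refine ⟨1, ?_, fun _ => rfl, fun h => absurd h hn0.ne⟩
        simpa [act_one, hx, Hyp3.hdist_self] using hD0
      · by_cases hin : i = n
        · refine ⟨g ^ m, ?_, fun h => absurd h h0, fun _ => rfl⟩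
          rw [hYpow, hin, hd, mul_div_cancel₀ _ hn0'.ne', Hyp3.hdist_self]
          exact hD0
        · obtain ⟨k, hk⟩ := hD x (hY 0) (Y (i * d)) (hY _)
          exact ⟨k, hk, fun h => absurd h h0, fun h => absurd h hin⟩
    choose k hk hk0 hkn using hk
    have hstep : ∀ i : ℕ, (k i)⁻¹ * k (i + 1) ∈ S := by
      intro i
      have h1 : Hyp3.hdist x (act ρ ((k i)⁻¹ * k (i + 1)) x) =
          Hyp3.hdist (act ρ (k i) x) (act ρ (k (i + 1)) x) := by
        rw [← hdist_act (k i), ← act_mul, mul_inv_cancel_left]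
      have h2 := Hyp3.hdist_triangle (act ρ (k i) x) (Y (i * d)) (act ρ (k (i + 1)) x)
      have h3 := Hyp3.hdist_triangle (Y (i * d)) (Y ((i + 1 : ℕ) * d)) (act ρ (k (i + 1)) x)
      have h4 := hk (i + 1)
      rw [Hyp3.hdist_comm] at h4
      have h5 : Hyp3.hdist (Y (i * d)) (Y ((i + 1 : ℕ) * d)) = d := by
        rw [hYd]
        push_cast
        rw [show ((i : ℝ) + 1) * d - i * d = d by ring, abs_of_pos hd0]
      change Hyp3.hdist x (act ρ ((k i)⁻¹ * k (i + 1)) x) ≤ L / 2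
      rw [h1]
      linarith [hk i]
    have hsum : ∀ i : ℕ, Hyp3.hdist y (act ρs (k i) y) ≤ i * E := by
      intro i
      induction i with
      | zero => simp [hk0 0 rfl, act_one, Hyp3.hdist_self]
      | succ i ih =>
        have h1 := Hyp3.hdist_triangle y (act ρs (k i) y) (act ρs (k (i + 1)) y)
        have h2 := hy _ (hstep i)
        rw [← hdist_act (k i), ← act_mul, mul_inv_cancel_left] at h2
        push_cast
        linarith
    have h1 := hsum n
    rw [hkn n rfl] at h1
    have h2 := length_le_hdist ρs (g ^ m) y
    rw [length_pow] at h2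
    exact (h2.trans h1).trans (mul_le_mul_of_nonneg_right hnlt.le hE0)
  -- The rounding error `E` from the ceiling disappears on passing to large powers.
  have hlim : Tendsto (fun m : ℕ => 2 * T / (L - 4 * D) * E + E / m) atTop
      (𝓝 (2 * T / (L - 4 * D) * E + 0)) :=
    tendsto_const_nhds.add (tendsto_const_div_atTop_nhds_zero_nat _)
  rw [add_zero] at hlim
  refine ge_of_tendsto hlim ?_
  filter_upwards [eventually_gt_atTop 0] with m hm
  have hm' : (0 : ℝ) < m := by exact_mod_cast hm
  have := hbound m hm
  rw [← mul_le_mul_iff_right₀ hm']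
  refine this.trans_eq ?_
  field_simp

end PSLRep

theorem mainTheorem6 :
    ∃ K : ℝ, 0 < K ∧
      ∀ (Γ : Type*) [Group Γ], IsHyperbolicSurfaceGroup Γ →
      ∀ ρ ρs : Γ →* PSL(2, ℂ), PSLRep.ConvexCocompact ρ → PSLRep.ConvexCocompact ρs →
      ∀ D L : ℝ, 0 ≤ D → PSLRep.HullCobounded ρ D → 6 * D < L →
        (∀ g : Γ, ¬ IsOfFinOrder g → 0 < PSLRep.length ρ g) ∧
        ∃ M Dil : ℝ,
          IsGreatest {r : ℝ | ∃ g : Γ, 0 < PSLRep.length ρ g ∧ PSLRep.length ρ g ≤ L ∧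
            r = PSLRep.length ρs g / PSLRep.length ρ g} M ∧
          IsLUB {r : ℝ | ∃ g : Γ, ¬ IsOfFinOrder g ∧
            r = PSLRep.length ρs g / PSLRep.length ρ g} Dil ∧
          Dil ≤ L / (L - 6 * D) * M + 2 * K * Real.log 4 / (L - 6 * D) := by
  have hlog4 : 0 < Real.log 4 := Real.log_pos (by norm_num)
  have hlog : 0 < Real.log 132 := Real.log_pos (by norm_num)
  -- Chosen so that `K * log 4 = log 132`, the additive constant of the joint displacement bound.
  refine ⟨Real.log 132 / Real.log 4, by positivity, ?_⟩
  intro Γ _ hΓ ρ ρs hρ _ D L hD0 hD hL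
  have hpos : ∀ g : Γ, ¬ IsOfFinOrder g → 0 < PSLRep.length ρ g := fun g hg =>
    (hρ.exists_axis hD hg).1
  refine ⟨hpos, ?_⟩
  obtain ⟨g₀, hg₀, hg₀0, hg₀L⟩ := hρ.exists_length_le hΓ hD hD0 (by linarith : 2 * D < L)
  obtain ⟨M, hM⟩ : ∃ M, IsGreatest {r : ℝ | ∃ g : Γ, 0 < PSLRep.length ρ g ∧
      PSLRep.length ρ g ≤ L ∧ r = PSLRep.length ρs g / PSLRep.length ρ g} M := by
    obtain ⟨M, hM, hMle⟩ := Set.exists_max_image _ id (hρ.finite_ratios hD ρs L)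
      ⟨_, g₀, hg₀0, hg₀L, rfl⟩
    exact ⟨M, hM, hMle⟩
  have hM0 : 0 ≤ M := (div_nonneg (PSLRep.length_nonneg ρs g₀) hg₀0.le).trans
    (hM.2 ⟨g₀, hg₀0, hg₀L, rfl⟩)
  have hL6 : 0 < L - 6 * D := by linarith
  have hL0 : 0 < L := by linarith
  have hub : ∀ r ∈ {r : ℝ | ∃ g : Γ, ¬ IsOfFinOrder g ∧
      r = PSLRep.length ρs g / PSLRep.length ρ g},
      r ≤ L / (L - 6 * D) * M + 2 * (Real.log 132 / Real.log 4) * Real.log 4 / (L - 6 * D) := by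
    rintro _ ⟨g, hg, rfl⟩
    have h1 := hρ.length_le_of_short_ratio_le ρs hD hD0 (by linarith : 4 * D < L) hM0
      (fun f h0 h1 => hM.2 ⟨f, h0, h1, rfl⟩) hg
    have h2 := hpos g hg
    rw [div_le_iff₀ h2]
    refine h1.trans ?_
    have h3 : 2 * PSLRep.length ρ g / (L - 4 * D) ≤ 2 * PSLRep.length ρ g / (L - 6 * D) :=
      div_le_div_of_nonneg_left (by positivity) hL6 (by linarith)
    refine (mul_le_mul_of_nonneg_right h3 (by positivity)).trans_eq ?_
    rw [mul_assoc 2, div_mul_cancel₀ _ hlog4.ne']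
    field_simp
  have hne : {r : ℝ | ∃ g : Γ, ¬ IsOfFinOrder g ∧
      r = PSLRep.length ρs g / PSLRep.length ρ g}.Nonempty := ⟨_, g₀, hg₀, rfl⟩
  exact ⟨M, _, hM, isLUB_csSup hne ⟨_, hub⟩, csSup_le hne hub⟩
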